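/- Let ${\bf e}_1,{\bf e}_2\in\mathbb{R}^2$ be linearly independent, and let $\Omega_1,\dots,\Omega_N\subset\mathbb{R}^2$ ($N\ge 0$) be bounded open sets, each with boundary $\Gamma_i=\partial\Omega_i$ a $C^\infty$ regular simple closed curve, such that the closed lattice translates $\overline{\Omega}_i+m_1{\bf e}_1+m_2{\bf e}_2$ ($1\le i\le N$, $m_1,m_2\in\mathbb{Z}$) are pairwise disjoint. Let $\Omega_\Lambda$ be the union of all the lattice translates of $\Omega_1,\dots,\Omega_N$. Let ${\bf x}_i^c=\frac{1}{|\Gamma_i|}\int_{\Gamma_i}{\bf x}\,ds$, let ${\bf n}$ be the unit normal on $\Gamma_i$ pointing out of $\Omega_i$, write ${\bf x}^\perp=(-x_2,x_1)$, and let $\mu>0$. For a velocity ${\bf u}$ and a pressure $p$ put $$\sigma_{ij}=-\delta_{ij}\,p+\mu\Big(\frac{\partial u_i}{\partial x_j}+\frac{\partial u_j}{\partial x_i}\Big),\qquad {\bf T}=\sigma{\bf n}.$$ Suppose that ${\bf u}$ is $C^2$ in $\mathbb{R}^2\setminus\overline{\Omega}_\Lambda$ and $C^1$ up to the boundary, that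 $p$ is $C^1$ in $\mathbb{R}^2\setminus\overline{\Omega}_\Lambda$ and continuous up to the boundary, and that $({\bf u},p)$ solves the periodic mobility boundary value problem with zero background flow, that is, for some ${\bf v}_i\in\mathbb{R}^2$ and $\omega_i\in\mathbb{R}$ ($1\le i\le N$), \begin{align*} -\mu\Delta{\bf u}+\nabla p&=0,\qquad \nabla\cdot{\bf u}=0 \qquad\text{in }\mathbb{R}^2\setminus\overline{\Omega}_\Lambda,\\ {\bf u}({\bf x})&={\bf v}_i+\omega_i({\bf x}-{\bf x}_i^c)^\perp\qquad({\bf x}\in\Gamma_i,\ 1\le i\le N),\\ \int_{\Gamma_i}{\bf T}\,ds&={\bf 0},\qquad \int_{\Gamma_i}\big({\bf T},({\bf x}-{\bf x}_i^c)^\perp\big)\,ds=0\qquad(1\le i\le N),\\ {\bf u}({\bf x}+m_1{\bf e}_1+m_2{\bf e}_2)&={\bf u}({\bf x}),\qquad p({\bf x}+m_1{\bf e}_1+m_2{\bf e}_2)=p({\bf x})\qquad(m_1,m_2\in\mathbb{Z}). \end{align*} Then ${\bf u}$ and $p$ are constant on $\mathbb{R}^2\setminus\Omega_\Lambda$, that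 is, in the fluid and on the boundaries of the objects. -/

import Mathlib

noncomputable section

namespace PeriodicMobility

/-- The Euclidean plane. -/
abbrev Plane : Type := EuclideanSpace ℝ (Fin 2)

/-- The rotation by a right angle, `(x₁, x₂) ↦ (-x₂, x₁)`. -/
def perp (x : Plane) : Plane := !₂[-x 1, x 0]

/-- A bounded smooth object in the plane: a bounded open set whose boundary is a smooth regular
simple closed curve, parametrized with period `2π` and positively oriented (the object lies to the
left of the direction of travel). -/
structure SmoothObject where
  /-- the (open) object -/
  body : Set Plane
  /-- the parametrization of its boundary -/
  curve : ℝ → Plane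
  isOpen_body : IsOpen body
  isBounded_body : Bornology.IsBounded body
  contDiff_curve : ContDiff ℝ (⊤ : ℕ∞) curve
  periodic_curve : Function.Periodic curve (2 * Real.pi)
  injOn_curve : Set.InjOn curve (Set.Ico 0 (2 * Real.pi))
  deriv_curve_ne_zero : ∀ t, deriv curve t ≠ 0
  frontier_body : frontier body = Set.range curve
  positively_oriented :
    ∀ t, ∀ᶠ s in nhdsWithin (0 : ℝ) (Set.Ioi 0), curve t + s • perp (deriv curve t) ∈ body

namespace SmoothObject

variable (B : SmoothObject)

/-- The integral with respect to arc length over the boundary of the object, of a function that is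
given in terms of the boundary parameter. -/
def boundaryIntegral {G : Type*} [NormedAddCommGroup G] [NormedSpace ℝ G] (f : ℝ → G) : G :=
  ∫ t in (0 : ℝ)..(2 * Real.pi), ‖deriv B.curve t‖ • f t

/-- The length of the boundary. -/
def perimeter : ℝ := B.boundaryIntegral fun _ => (1 : ℝ)

/-- The centroid, that is, the mean position over the boundary. -/
def centroid : Plane := B.perimeter⁻¹ • B.boundaryIntegral B.curve

/-- The unit normal vector at the boundary point with parameter `t` that points out of the
object (the unit tangent vector turned clockwise by a right angle). -/
def outwardNormal (t : ℝ) : Plane := -(‖deriv B.curve t‖⁻¹ • perp (deriv B.curve t))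

end SmoothObject

/-- The lattice vector `m₁ e₁ + m₂ e₂`. -/
def latticeVector (e₁ e₂ : Plane) (m₁ m₂ : ℤ) : Plane := (m₁ : ℝ) • e₁ + (m₂ : ℝ) • e₂

/-- A doubly periodic suspension with `N` objects per unit cell: two linearly independent lattice
vectors and `N` smooth objects, such that no two of the closed lattice translates of the objects
meet. The objects may cross the walls of any particular unit cell. -/
structure Suspension (N : ℕ) where
  e₁ : Plane
  e₂ : Plane
  linearIndependent : LinearIndependent ℝ ![e₁, e₂]
  object : Fin N → SmoothObject
  disjoint_translates : ∀ (i j : Fin N) (m₁ m₂ : ℤ), (i, m₁, m₂) ≠ (j, 0, 0) →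
    Disjoint ((fun x => x + latticeVector e₁ e₂ m₁ m₂) '' closure (object i).body)
      (closure (object j).body)

namespace Suspension

variable {N : ℕ} (S : Suspension N)

/-- The infinite lattice of (open) objects. -/
def solid : Set Plane :=
  {x | ∃ (j : Fin N) (m₁ m₂ : ℤ), x + latticeVector S.e₁ S.e₂ m₁ m₂ ∈ (S.object j).body}

/-- The open domain of the suspending fluid. -/
def fluid : Set Plane := (closure S.solid)ᶜ

/-- The fluid domain together with the boundaries of all the objects. -/
def closedFluid : Set Plane := S.solidᶜ

end Suspension

/-- The partial derivative `∂ uᵢ / ∂ xⱼ` at `x`, taken within the set `D` (it is the usual partial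
derivative at interior points, and the one-sided one at boundary points). -/
def partialWithin (D : Set Plane) (u : Plane → Plane) (x : Plane) (i j : Fin 2) : ℝ :=
  (fderivWithin ℝ u D x (EuclideanSpace.single j 1)) i

/-- The stress tensor `σᵢⱼ = -δᵢⱼ p + μ (∂ uᵢ / ∂ xⱼ + ∂ uⱼ / ∂ xᵢ)`. -/
def stress (μ : ℝ) (D : Set Plane) (u : Plane → Plane) (p : Plane → ℝ) (x : Plane) :
    Matrix (Fin 2) (Fin 2) ℝ :=
  Matrix.of fun i j =>
    -(if i = j then p x else 0) + μ * (partialWithin D u x i j + partialWithin D u x j i)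

/-- The traction `σ n` for the normal vector `n`. -/
def traction (μ : ℝ) (D : Set Plane) (u : Plane → Plane) (p : Plane → ℝ) (x n : Plane) : Plane :=
  WithLp.toLp 2 ((stress μ D u p x).mulVec n.ofLp)

/-- The traction at the point with parameter `t` of the boundary of the `i`-th object. -/
def Suspension.boundaryTraction {N : ℕ} (S : Suspension N) (μ : ℝ) (u : Plane → Plane)
    (p : Plane → ℝ) (i : Fin N) (t : ℝ) : Plane :=
  traction μ S.closedFluid u p ((S.object i).curve t) ((S.object i).outwardNormal t)

/-- `(u, p)`, with the linear velocities `v` and the angular velocities `ω` of the objects, is a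
classical solution of the periodic quasi-static mobility boundary value problem for the suspension
`S`, the viscosity `μ` and the background flow `u₀`. Only the values of `u` and `p` in the fluid and
on the boundaries of the objects play a role. -/
structure IsMobilitySolution {N : ℕ} (S : Suspension N) (μ : ℝ) (u₀ : Plane → Plane)
    (u : Plane → Plane) (p : Plane → ℝ) (v : Fin N → Plane) (ω : Fin N → ℝ) : Prop where
  contDiffOn_velocity : ContDiffOn ℝ 2 u S.fluid
  contDiffOn_velocity_closed : ContDiffOn ℝ 1 u S.closedFluid
  contDiffOn_pressure : ContDiffOn ℝ 1 p S.fluid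
  continuousOn_pressure_closed : ContinuousOn p S.closedFluid
  stokes : ∀ x ∈ S.fluid, -(μ • Laplacian.laplacian u x) + gradient p x = 0
  incompressible : ∀ x ∈ S.fluid, ∑ i, fderiv ℝ u x (EuclideanSpace.single i 1) i = 0
  rigid : ∀ i, ∀ x ∈ frontier (S.object i).body,
    u x + u₀ x = v i + ω i • perp (x - (S.object i).centroid)
  force_free : ∀ i, (S.object i).boundaryIntegral (S.boundaryTraction μ u p i) = 0
  torque_free : ∀ i, (S.object i).boundaryIntegral (fun t =>
    inner ℝ (S.boundaryTraction μ u p i t)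
      (perp ((S.object i).curve t - (S.object i).centroid))) = 0
  periodic_velocity : ∀ x ∈ S.closedFluid, ∀ m₁ m₂ : ℤ,
    u (x + latticeVector S.e₁ S.e₂ m₁ m₂) = u x
  periodic_pressure : ∀ x ∈ S.closedFluid, ∀ m₁ m₂ : ℤ,
    p (x + latticeVector S.e₁ S.e₂ m₁ m₂) = p x

end PeriodicMobility

end

/-! The proof is an energy argument on the torus. In the fluid the divergence of `σu` is the
dissipation density `(μ/2) ∑ (∂ⱼuᵢ + ∂ᵢuⱼ)²` (`divergence_power`). Integrated over a cell, the
periodic contributions cancel. On `Γᵢ` the rigid velocity turns the power `∫ (T, u) ds` into `vᵢ`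
paired with the total force plus `ωᵢ` times the total torque, hence into zero (`flux_power`). So the
dissipation vanishes (`dissipation_eq_zero`). The second derivatives of `u` are then antisymmetric
in one pair of indices and symmetric in another, so they vanish (`second_eq_zero`), and the Stokes
equation gives `∇p = 0`. On a connected fluid domain `u` is therefore affine and `p` is constant;
periodicity kills the linear part of `u` (`velocity_eq`).

Two points need work. The integration by parts takes place where second derivatives are only
controlled inside the fluid, and objects may cross the walls of the cell. It is done with cutoff
functions `χ_b` that depend only on the transverse coordinate of a collar around each curve. With
`χ_b` the identity reads `∫ χ_b D = -∫ dχ_b(σu)` for the dissipation density `D`, with no boundary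
term (`integral_cell_fderiv`). The right side is a weighted mean of fluxes through curves parallel
to `Γᵢ`, which tends to the flux through `Γᵢ` as `b → 0` (`exists_flux_le`).

Connectedness of the fluid is not assumed either. A locally constant function on the fluid,
continuous up to the boundary, has one value along the boundary of each translate because the outer
collar is connected; filling the object with that value gives a locally constant function on the
plane (`eq_of_locally_constant_on_fluid`). -/

noncomputable section
namespace PeriodicMobility

/-! ### Linear algebra in the plane. -/

/-- The coordinate vectors of the plane. -/
abbrev coord (j : Fin 2) : Plane := EuclideanSpace.single j 1

/-- The determinant of the two vectors `a` and `b`. -/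
def det2 (a b : Plane) : ℝ := a 0 * b 1 - a 1 * b 0

lemma plane_eq_sum (x : Plane) : x = x 0 • coord 0 + x 1 • coord 1 := by
  ext i; fin_cases i <;> simp [coord]

lemma det_eq_det2 (L : Plane →L[ℝ] Plane) : L.det = det2 (L (coord 0)) (L (coord 1)) := by
  rw [ContinuousLinearMap.det,
    ← LinearMap.det_toMatrix (EuclideanSpace.basisFun (Fin 2) ℝ).toBasis, Matrix.det_fin_two]
  simp [LinearMap.toMatrix_apply, det2, coord]
  ring

/-- Cramer's rule without division. With `l` the differential of the cutoff and `a`, `b` the collar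
directions, it turns Jacobian times directional derivative into a flux. -/
lemma cramer_identity (l : Plane →L[ℝ] ℝ) (a b c : Plane) :
    l c * det2 a b = l a * det2 c b + l b * det2 a c := by
  rw [plane_eq_sum a, plane_eq_sum b, plane_eq_sum c]
  simp [det2, coord]
  ring

lemma inner_eq_sum (a b : Plane) : inner ℝ a b = a 0 * b 0 + a 1 * b 1 := by
  simp [PiLp.inner_apply, Fin.sum_univ_two]; ring

/-- The rotation by a right angle as a continuous linear map. -/
def perpL : Plane →L[ℝ] Plane :=
  LinearMap.toContinuousLinearMap
    { toFun := perp
      map_add' := fun x y => by ext i; fin_cases i <;> simp [perp]; ring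
      map_smul' := fun c x => by ext i; fin_cases i <;> simp [perp] }

@[simp] lemma perpL_apply (x : Plane) : perpL x = perp x := rfl

@[simp] lemma perp_zero_coord (x : Plane) : perp x 0 = -x 1 := by simp [perp]
@[simp] lemma perp_one_coord (x : Plane) : perp x 1 = x 0 := by simp [perp]

lemma det2_perp_pos {a : Plane} (ha : a ≠ 0) : 0 < det2 a (perp a) := by
  have : 0 < inner ℝ a a := real_inner_self_pos.2 ha
  rw [inner_eq_sum] at this
  simp [det2]; linarith

lemma continuous_det2 : Continuous fun q : Plane × Plane => det2 q.1 q.2 := by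
  unfold det2; fun_prop

/-! ### Collar coordinates along one boundary curve. -/

namespace SmoothObject

variable (B : SmoothObject)

/-- The collar map `(t, s) ↦ γ(t) - s (dγ/dt)^⊥`, which points out of the object for `s > 0`. -/
def collarMap (y : Plane) : Plane := B.curve (y 0) - y 1 • perp (deriv B.curve (y 0))

lemma contDiff_deriv_curve : ContDiff ℝ (⊤ : ℕ∞) (deriv B.curve) :=
  (contDiff_infty_iff_deriv.1 B.contDiff_curve).2

lemma contDiff_coord (j : Fin 2) {n : WithTop ℕ∞} : ContDiff ℝ n fun y : Plane => y j :=
  (EuclideanSpace.proj j : Plane →L[ℝ] ℝ).contDiff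

lemma contDiff_collarMap : ContDiff ℝ (⊤ : ℕ∞) B.collarMap := by
  have h0 : ContDiff ℝ (⊤ : ℕ∞) fun y : Plane => y 0 := contDiff_coord 0
  have h1 : ContDiff ℝ (⊤ : ℕ∞) fun y : Plane => y 1 := contDiff_coord 1
  exact (B.contDiff_curve.comp h0).sub
    (h1.smul (perpL.contDiff.comp (B.contDiff_deriv_curve.comp h0)))

lemma continuous_collarMap : Continuous B.collarMap := B.contDiff_collarMap.continuous

lemma differentiable_collarMap : Differentiable ℝ B.collarMap :=
  B.contDiff_collarMap.differentiable (by simp)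

lemma fderiv_collarMap_zero (y : Plane) : fderiv ℝ B.collarMap y (coord 0) =
    deriv B.curve (y 0) - y 1 • perp (deriv (deriv B.curve) (y 0)) := by
  have h := (B.differentiable_collarMap y).hasFDerivAt.comp_hasDerivAt_of_eq (x := y 0)
    (f := fun t : ℝ => y + (t - y 0) • coord 0)
    (((((hasDerivAt_id (y 0)).sub_const (y 0)).smul_const (coord 0)).const_add y)) (by simp)
  have hγ : HasDerivAt B.curve (deriv B.curve (y 0)) (y 0) :=
    (B.contDiff_curve.differentiable (by simp) _).hasDerivAt
  have hγ' : HasDerivAt (deriv B.curve) (deriv (deriv B.curve) (y 0)) (y 0) :=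
    (B.contDiff_deriv_curve.differentiable (by simp) _).hasDerivAt
  have h2 := hγ.sub ((perpL.hasFDerivAt.comp_hasDerivAt (y 0) hγ').const_smul (y 1))
  have h3 := h.unique (h2.congr_of_eventuallyEq (Filter.Eventually.of_forall fun t => ?_))
  · simpa using h3
  · simp [collarMap, coord]

lemma fderiv_collarMap_one (y : Plane) : fderiv ℝ B.collarMap y (coord 1) =
    -perp (deriv B.curve (y 0)) := by
  have h := (B.differentiable_collarMap y).hasFDerivAt.comp_hasDerivAt_of_eq (x := y 1)
    (f := fun t : ℝ => y + (t - y 1) • coord 1)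
    (((((hasDerivAt_id (y 1)).sub_const (y 1)).smul_const (coord 1)).const_add y)) (by simp)
  have h2 := ((hasDerivAt_id (y 1)).smul_const (perp (deriv B.curve (y 0)))).const_sub
    (B.curve (y 0))
  have h3 := h.unique (h2.congr_of_eventuallyEq (Filter.Eventually.of_forall fun t => ?_))
  · simpa using h3
  · simp [collarMap, coord]

/-- The Jacobian determinant of the collar map. -/
def collarJacobian (y : Plane) : ℝ := (fderiv ℝ B.collarMap y).det

lemma collarJacobian_eq (y : Plane) : B.collarJacobian y =
    det2 (fderiv ℝ B.collarMap y (coord 0)) (fderiv ℝ B.collarMap y (coord 1)) :=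
  det_eq_det2 _

lemma continuous_collarJacobian : Continuous B.collarJacobian := by
  have h : Continuous fun y => fderiv ℝ B.collarMap y :=
    B.contDiff_collarMap.continuous_fderiv (by simp)
  simp only [funext B.collarJacobian_eq]
  exact continuous_det2.comp (by fun_prop : Continuous fun y =>
    (fderiv ℝ B.collarMap y (coord 0), fderiv ℝ B.collarMap y (coord 1)))

lemma periodic_deriv_curve : Function.Periodic (deriv B.curve) (2 * Real.pi) := by
  intro t
  rw [← deriv_comp_add_const, show (fun x => B.curve (x + 2 * Real.pi)) = B.curve from
    funext B.periodic_curve]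

lemma collarMap_add_period (y : Plane) (k : ℤ) :
    B.collarMap (y + (k * (2 * Real.pi)) • coord 0) = B.collarMap y := by
  simp only [collarMap, PiLp.add_apply, PiLp.smul_apply, coord]
  simp [B.periodic_curve.int_mul k (y 0), B.periodic_deriv_curve.int_mul k (y 0)]

lemma fderiv_collarMap_add_period (y : Plane) (k : ℤ) :
    fderiv ℝ B.collarMap (y + (k * (2 * Real.pi)) • coord 0) = fderiv ℝ B.collarMap y := by
  rw [← fderiv_comp_add_right]
  congr 1
  exact funext fun y => B.collarMap_add_period y k

/-- On the curve itself the columns are `γ'` and `-(γ')^⊥`, whose determinant is `-|γ'|²`. -/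
lemma collarJacobian_neg_of_eq_zero {y : Plane} (hy : y 1 = 0) : B.collarJacobian y < 0 := by
  rw [collarJacobian_eq, fderiv_collarMap_zero, fderiv_collarMap_one, hy]
  have := det2_perp_pos (B.deriv_curve_ne_zero (y 0))
  simp [det2] at this ⊢; linarith

/-- Near a point where the Jacobian does not vanish, the collar map has a smooth local inverse. -/
lemma exists_local_inverse {y : Plane} (hy : B.collarJacobian y ≠ 0) :
    ∃ e : OpenPartialHomeomorph Plane Plane, y ∈ e.source ∧ (∀ z, e z = B.collarMap z) ∧
      ContDiffAt ℝ (⊤ : ℕ∞) e.symm (B.collarMap y) := by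
  let A : Plane ≃L[ℝ] Plane := (fderiv ℝ B.collarMap y).toContinuousLinearEquivOfDetNeZero hy
  have hA : HasFDerivAt B.collarMap (A : Plane →L[ℝ] Plane) y := by
    have h := (B.differentiable_collarMap y).hasFDerivAt
    rwa [← ContinuousLinearMap.coe_toContinuousLinearEquivOfDetNeZero _ hy] at h
  have hn : ((⊤ : ℕ∞) : WithTop ℕ∞) ≠ 0 := by simp
  have hc := B.contDiff_collarMap.contDiffAt (x := y)
  refine ⟨hc.toOpenPartialHomeomorph B.collarMap hA hn,
    hc.mem_toOpenPartialHomeomorph_source hA hn, fun z => ?_, hc.to_localInverse hA hn⟩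
  rw [hc.toOpenPartialHomeomorph_coe hA hn]

lemma exists_injOn_nhds {y : Plane} (hy : B.collarJacobian y ≠ 0) :
    ∃ U ∈ nhds y, Set.InjOn B.collarMap U := by
  obtain ⟨e, he, hez, -⟩ := B.exists_local_inverse hy
  refine ⟨e.source, e.open_source.mem_nhds he, fun a ha b hb hab => ?_⟩
  exact e.injOn ha hb (by simpa [hez] using hab)

/-- The curve is injective modulo its period. -/
lemma exists_period_of_curve_eq {t t' : ℝ} (h : B.curve t = B.curve t') :
    ∃ k : ℤ, t' = t + k * (2 * Real.pi) := by
  have hp : 0 < 2 * Real.pi := Real.two_pi_pos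
  have key : ∀ t, B.curve (toIcoMod hp 0 t) = B.curve t := fun t => by
    rw [toIcoMod]
    exact B.periodic_curve.sub_zsmul_eq _
  have hm : ∀ t, toIcoMod hp 0 t ∈ Set.Ico 0 (2 * Real.pi) := fun t => by
    simpa using toIcoMod_mem_Ico hp 0 t
  have := B.injOn_curve (hm t) (hm t') (by rw [key, key, h])
  refine ⟨toIcoDiv hp 0 t' - toIcoDiv hp 0 t, ?_⟩
  have h1 := toIcoMod_add_toIcoDiv_zsmul hp 0 t
  have h2 := toIcoMod_add_toIcoDiv_zsmul hp 0 t'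
  simp only [zsmul_eq_mul] at h1 h2
  push_cast
  linarith

end SmoothObject

/-- The point of the plane with given coordinates. -/
def point (t s : ℝ) : Plane := !₂[t, s]

@[simp] lemma point_zero (t s : ℝ) : point t s 0 = t := by simp [point]
@[simp] lemma point_one (t s : ℝ) : point t s 1 = s := by simp [point]
lemma point_coords (y : Plane) : point (y 0) (y 1) = y := by ext i; fin_cases i <;> simp [point]

lemma point_eq (t s : ℝ) : point t s = t • coord 0 + s • coord 1 := by
  conv_lhs => rw [plane_eq_sum (point t s)]
  simp

lemma continuous_point : Continuous fun q : ℝ × ℝ => point q.1 q.2 := by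
  simp only [point_eq]; fun_prop

namespace SmoothObject

variable (B : SmoothObject)

lemma collarMap_point_zero (t : ℝ) : B.collarMap (point t 0) = B.curve t := by simp [collarMap]

lemma exists_collar_shift (y : Plane) : ∃ k : ℤ, ∃ t ∈ Set.Icc 0 (2 * Real.pi),
    y = point t (y 1) + ((k : ℝ) * (2 * Real.pi)) • coord 0 := by
  have hp : 0 < 2 * Real.pi := Real.two_pi_pos
  refine ⟨toIcoDiv hp 0 (y 0), toIcoMod hp 0 (y 0),
    Set.Ico_subset_Icc_self (by simpa using toIcoMod_mem_Ico hp 0 (y 0)), ?_⟩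
  have h1 := toIcoMod_add_toIcoDiv_zsmul hp 0 (y 0)
  rw [zsmul_eq_mul] at h1
  ext i; fin_cases i <;> simp [h1]

lemma curve_mem_frontier (t : ℝ) : B.curve t ∈ frontier B.body := by
  rw [B.frontier_body]; exact ⟨t, rfl⟩

lemma curve_mem_closure (t : ℝ) : B.curve t ∈ closure B.body :=
  frontier_subset_closure (B.curve_mem_frontier t)

end SmoothObject

/-! ### The lattice, and a collar width common to all objects. -/

namespace Suspension

variable {N : ℕ} (S : Suspension N)

/-- The lattice vectors of the suspension. -/
def shift (m₁ m₂ : ℤ) : Plane := latticeVector S.e₁ S.e₂ m₁ m₂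

@[simp] lemma shift_zero : S.shift 0 0 = 0 := by simp [shift, latticeVector]

lemma shift_add (m₁ m₂ n₁ n₂ : ℤ) :
    S.shift (m₁ + n₁) (m₂ + n₂) = S.shift m₁ m₂ + S.shift n₁ n₂ := by
  simp only [shift, latticeVector]; push_cast; module

lemma shift_neg (m₁ m₂ : ℤ) : S.shift (-m₁) (-m₂) = -S.shift m₁ m₂ := by
  simp only [shift, latticeVector]; push_cast; module

/-- The basis of the plane that consists of the two lattice vectors. -/
def basis : Module.Basis (Fin 2) ℝ Plane :=
  basisOfLinearIndependentOfCardEqFinrank S.linearIndependent (by simp)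

@[simp] lemma basis_zero : S.basis 0 = S.e₁ := by simp [basis]
@[simp] lemma basis_one : S.basis 1 = S.e₂ := by simp [basis]

lemma repr_shift (m₁ m₂ : ℤ) :
    S.basis.coord 0 (S.shift m₁ m₂) = m₁ ∧ S.basis.coord 1 (S.shift m₁ m₂) = m₂ := by
  rw [shift, latticeVector, ← basis_zero, ← basis_one]
  constructor <;> simp [-basis_zero, -basis_one]

/-- Lattice coordinates are bounded linear functionals with integer values here. This discreteness
leaves only finitely many translates to compare. -/
lemma finite_shift_le (C : ℝ) : {m : ℤ × ℤ | ‖S.shift m.1 m.2‖ ≤ C}.Finite := by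
  obtain ⟨K, hK⟩ : ∃ K : ℕ, ∀ j, ‖(S.basis.coord j).toContinuousLinearMap‖ * |C| ≤ K := by
    obtain ⟨a, ha⟩ := exists_nat_ge (‖(S.basis.coord 0).toContinuousLinearMap‖ * |C|)
    obtain ⟨b, hb⟩ := exists_nat_ge (‖(S.basis.coord 1).toContinuousLinearMap‖ * |C|)
    refine ⟨a + b, fun j => ?_⟩
    push_cast
    have h1 : (0 : ℝ) ≤ a := a.cast_nonneg
    have h2 : (0 : ℝ) ≤ b := b.cast_nonneg
    fin_cases j
    · exact ha.trans (by linarith)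
    · exact hb.trans (by linarith)
  refine (Set.finite_Icc ((-K, -K) : ℤ × ℤ) (K, K)).subset fun m hm => ?_
  have key : ∀ j, |S.basis.coord j (S.shift m.1 m.2)| ≤ K := fun j => by
    have := (S.basis.coord j).toContinuousLinearMap.le_opNorm (S.shift m.1 m.2)
    refine le_trans this (le_trans ?_ (hK j))
    gcongr
    exact hm.trans (le_abs_self C)
  have h0 := key 0
  have h1 := key 1
  rw [(S.repr_shift m.1 m.2).1, abs_le] at h0
  rw [(S.repr_shift m.1 m.2).2, abs_le] at h1
  refine ⟨⟨?_, ?_⟩, ?_, ?_⟩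
  · exact_mod_cast h0.1
  · exact_mod_cast h1.1
  · exact_mod_cast h0.2
  · exact_mod_cast h1.2

/-- `δ` is a width for which the collars of all the objects and of their translates are embedded
and pairwise disjoint. -/
structure IsCollarWidth (δ : ℝ) : Prop where
  pos : 0 < δ
  jacobian_neg : ∀ i y, |y 1| < δ → (S.object i).collarJacobian y < 0
  injective : ∀ i j m₁ m₂ y z, |y 1| < δ → |z 1| < δ →
    (S.object i).collarMap y + S.shift m₁ m₂ = (S.object j).collarMap z →
      i = j ∧ m₁ = 0 ∧ m₂ = 0 ∧ z 1 = y 1 ∧ ∃ k : ℤ, z 0 = y 0 + k * (2 * Real.pi)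

lemma eventually_jacobian_neg (i : Fin N) :
    ∀ᶠ s in nhds (0 : ℝ), ∀ y : Plane, y 1 = s → (S.object i).collarJacobian y < 0 := by
  have h := (isCompact_Icc (a := (0 : ℝ)) (b := 2 * Real.pi)).eventually_forall_of_forall_eventually
    (x₀ := (0 : ℝ)) (P := fun s t => (S.object i).collarJacobian (point t s) < 0) (fun t _ => by
      have hc : Continuous fun q : ℝ × ℝ => (S.object i).collarJacobian (point q.2 q.1) :=
        (S.object i).continuous_collarJacobian.comp (continuous_point.comp continuous_swap)
      exact hc.continuousAt.eventually (gt_mem_nhds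
        ((S.object i).collarJacobian_neg_of_eq_zero (by simp))))
  filter_upwards [h] with s hs y hy
  obtain ⟨k, t, ht, hyt⟩ := SmoothObject.exists_collar_shift y
  rw [hyt, SmoothObject.collarJacobian, SmoothObject.fderiv_collarMap_add_period, hy]
  exact hs t ht

lemma eq_of_curve_add_shift_eq {i j : Fin N} {m₁ m₂ : ℤ} {t t' : ℝ}
    (h : (S.object i).curve t + S.shift m₁ m₂ = (S.object j).curve t') :
    i = j ∧ m₁ = 0 ∧ m₂ = 0 := by
  by_contra hne
  have := S.disjoint_translates i j m₁ m₂ (by simpa using hne)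
  refine Set.disjoint_left.1 this ⟨_, (S.object i).curve_mem_closure t, rfl⟩ ?_
  change (S.object i).curve t + S.shift m₁ m₂ ∈ _
  rw [h]; exact (S.object j).curve_mem_closure t'

/-- Compactness in the two tangential parameters reduces the claim to a neighbourhood of each pair.
If the two boundary points differ, so do nearby images. If they agree, object and translate agree,
the parameters differ by `k` periods, and after moving the first by `k` periods both lie where the
collar map is injective. -/
lemma eventually_injective (i j : Fin N) (m₁ m₂ : ℤ) :
    ∀ᶠ q in nhds ((0, 0) : ℝ × ℝ), ∀ r ∈ Set.Icc 0 (2 * Real.pi) ×ˢ Set.Icc 0 (2 * Real.pi),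
      (S.object i).collarMap (point r.1 q.1) + S.shift m₁ m₂ = (S.object j).collarMap (point r.2 q.2) →
      i = j ∧ m₁ = 0 ∧ m₂ = 0 ∧ q.2 = q.1 ∧ ∃ k : ℤ, r.2 = r.1 + k * (2 * Real.pi) := by
  have hK : IsCompact (Set.Icc 0 (2 * Real.pi) ×ˢ Set.Icc 0 (2 * Real.pi) : Set (ℝ × ℝ)) :=
    isCompact_Icc.prod isCompact_Icc
  let P : ℝ × ℝ → ℝ × ℝ → Prop := fun q r =>
    (S.object i).collarMap (point r.1 q.1) + S.shift m₁ m₂ =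
      (S.object j).collarMap (point r.2 q.2) →
      i = j ∧ m₁ = 0 ∧ m₂ = 0 ∧ q.2 = q.1 ∧ ∃ k : ℤ, r.2 = r.1 + k * (2 * Real.pi)
  suffices hP : ∀ r ∈ (Set.Icc 0 (2 * Real.pi) ×ˢ Set.Icc 0 (2 * Real.pi) : Set (ℝ × ℝ)),
      ∀ᶠ z : (ℝ × ℝ) × ℝ × ℝ in nhds ((0, 0), r), P z.1 z.2 from
    hK.eventually_forall_of_forall_eventually hP
  rintro ⟨t, t'⟩ -
  have hc1 : Continuous fun z : (ℝ × ℝ) × ℝ × ℝ => point z.2.1 z.1.1 :=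
    continuous_point.comp (by fun_prop : Continuous fun z : (ℝ × ℝ) × ℝ × ℝ => (z.2.1, z.1.1))
  have hc2 : Continuous fun z : (ℝ × ℝ) × ℝ × ℝ => point z.2.2 z.1.2 :=
    continuous_point.comp (by fun_prop : Continuous fun z : (ℝ × ℝ) × ℝ × ℝ => (z.2.2, z.1.2))
  by_cases h : (S.object i).curve t + S.shift m₁ m₂ = (S.object j).curve t'
  · obtain ⟨rfl, rfl, rfl⟩ := S.eq_of_curve_add_shift_eq h
    rw [shift_zero, add_zero] at h
    obtain ⟨k, rfl⟩ := (S.object i).exists_period_of_curve_eq h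
    obtain ⟨U, hU, hinj⟩ := (S.object i).exists_injOn_nhds
      (y := point (t + k * (2 * Real.pi)) 0)
      ((S.object i).collarJacobian_neg_of_eq_zero (by simp)).ne
    have e1 : ∀ᶠ z in nhds (((0, 0), (t, t + k * (2 * Real.pi))) : (ℝ × ℝ) × ℝ × ℝ),
        point z.2.1 z.1.1 + ((k : ℝ) * (2 * Real.pi)) • coord 0 ∈ U := by
      have : Continuous fun z : (ℝ × ℝ) × ℝ × ℝ =>
        point z.2.1 z.1.1 + ((k : ℝ) * (2 * Real.pi)) • coord 0 := by fun_prop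
      refine this.continuousAt.eventually_mem ?_
      convert hU using 2
      ext l; fin_cases l <;> simp
    have e2 : ∀ᶠ z in nhds (((0, 0), (t, t + k * (2 * Real.pi))) : (ℝ × ℝ) × ℝ × ℝ),
        point z.2.2 z.1.2 ∈ U := hc2.continuousAt.eventually_mem hU
    filter_upwards [e1, e2] with z h1 h2 h3
    rw [shift_zero, add_zero, ← (S.object i).collarMap_add_period _ k] at h3
    have := hinj h1 h2 h3
    refine ⟨rfl, rfl, rfl, ?_, k, ?_⟩
    · have := congrArg (fun w : Plane => w 1) this
      simpa using this.symm
    · have := congrArg (fun w : Plane => w 0) this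
      simpa using this.symm
  · have hne := (isOpen_ne_fun (((S.object i).continuous_collarMap.comp hc1).add
      (continuous_const (y := S.shift m₁ m₂)))
      ((S.object j).continuous_collarMap.comp hc2)).mem_nhds (x := ((0, 0), (t, t')))
      (by simpa [SmoothObject.collarMap_point_zero] using h)
    filter_upwards [hne] with z hz h3
    exact absurd h3 hz

lemma exists_collarMap_bound :
    ∃ C : ℝ, ∀ i y, |y 1| ≤ 1 → ‖(S.object i).collarMap y‖ ≤ C := by
  have : ∀ i, ∃ C : ℝ, ∀ y, |y 1| ≤ 1 → ‖(S.object i).collarMap y‖ ≤ C := fun i => by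
    obtain ⟨C, hC⟩ := ((isCompact_Icc (a := (0 : ℝ)) (b := 2 * Real.pi)).prod
      (isCompact_Icc (a := (-1 : ℝ)) (b := 1))).exists_bound_of_continuousOn
      ((S.object i).continuous_collarMap.comp continuous_point).continuousOn
    refine ⟨C, fun y hy => ?_⟩
    obtain ⟨k, t, ht, hyt⟩ := SmoothObject.exists_collar_shift y
    rw [hyt, SmoothObject.collarMap_add_period]
    exact hC (t, y 1) ⟨ht, abs_le.1 hy⟩
  choose C hC using this
  refine ⟨∑ i, |C i|, fun i y hy => (hC i y hy).trans ((le_abs_self _).trans ?_)⟩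
  exact Finset.single_le_sum (f := fun i => |C i|) (fun i _ => abs_nonneg _) (Finset.mem_univ i)

/-- Collars of width at most one lie in a ball of radius `C`, so two of them can meet only after a
shift of norm at most `2C`. Finitely many such shifts remain, and each gives a neighbourhood of
zero. -/
lemma exists_isCollarWidth : ∃ δ, S.IsCollarWidth δ := by
  obtain ⟨C, hC⟩ := S.exists_collarMap_bound
  have h1 : ∀ᶠ s in nhds (0 : ℝ), ∀ i, ∀ y : Plane, y 1 = s → (S.object i).collarJacobian y < 0 :=
    Filter.eventually_all.2 S.eventually_jacobian_neg
  have h2 := (Filter.eventually_all_finite (S.finite_shift_le (2 * C))).2 fun m _ =>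
    Filter.eventually_all.2 fun i => Filter.eventually_all.2 fun j =>
      S.eventually_injective i j m.1 m.2
  obtain ⟨d, hd, h1⟩ := Metric.eventually_nhds_iff.1 h1
  obtain ⟨d', hd', h2⟩ := Metric.eventually_nhds_iff.1 h2
  -- The entry `1` keeps the collars in the range of `exists_collarMap_bound`.
  refine ⟨min 1 (min d d'), by positivity, fun i y hy => ?_, fun i j m₁ m₂ y z hy hz h => ?_⟩
  · exact h1 (y := y 1) (by simpa using hy.trans_le ((min_le_right _ _).trans (min_le_left _ _)))
      i y rfl
  · have hy1 := hy.le.trans (min_le_left _ _)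
    have hz1 := hz.le.trans (min_le_left _ _)
    have hm : ‖S.shift m₁ m₂‖ ≤ 2 * C := by
      have : S.shift m₁ m₂ = (S.object j).collarMap z - (S.object i).collarMap y := by
        rw [← h]; abel
      rw [this]
      refine (norm_sub_le _ _).trans ?_
      linarith [hC i y hy1, hC j z hz1]
    have hy2 := hy.trans_le ((min_le_right _ _).trans (min_le_right _ _))
    have hz2 := hz.trans_le ((min_le_right _ _).trans (min_le_right _ _))
    obtain ⟨k, t, ht, hyt⟩ := SmoothObject.exists_collar_shift y
    obtain ⟨k', t', ht', hzt⟩ := SmoothObject.exists_collar_shift z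
    rw [hyt, hzt, SmoothObject.collarMap_add_period, SmoothObject.collarMap_add_period] at h
    obtain ⟨a, b, c, e, l, hl⟩ := h2 (y := (y 1, z 1)) (by simp [Prod.dist_eq, hy2, hz2])
      (m₁, m₂) hm i j (t, t') ⟨ht, ht'⟩ h
    -- `k` and `k'` undo the reductions of `y` and `z` to one period.
    refine ⟨a, b, c, e, k' - k + l, ?_⟩
    have h0 := congrArg (fun w : Plane => w 0) hyt
    have h0' := congrArg (fun w : Plane => w 0) hzt
    simp only [PiLp.add_apply, point_zero, PiLp.smul_apply, coord] at h0 h0' hl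
    simp at h0 h0'
    push_cast
    linarith

end Suspension

/-! ### Topology of the solid and the fluid. -/

/-- Off the frontier, the plane splits into the two disjoint open sets `U` and the complement of its
closure. This decides on which side a whole collar lies from a single point. -/
lemma _root_.IsPreconnected.subset_of_disjoint_frontier {X : Type*} [TopologicalSpace X]
    {A U : Set X} (hA : IsPreconnected A) (hU : IsOpen U) (hne : (A ∩ U).Nonempty)
    (hd : ∀ x ∈ A, x ∉ frontier U) : A ⊆ U := by
  refine hA.subset_left_of_subset_union hU isClosed_closure.isOpen_compl
    (Set.disjoint_left.2 fun x hx hx' => hx' (subset_closure hx)) (fun x hx => ?_) hne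
  by_cases h : x ∈ closure U
  · left
    by_contra hxU
    exact hd x hx ⟨h, by rwa [hU.interior_eq]⟩
  · exact Or.inr h

lemma _root_.IsPreconnected.eq_of_locally_constant {X Y : Type*} [TopologicalSpace X]
    {A : Set X} (hA : IsPreconnected A) {g : X → Y}
    (hg : ∀ x ∈ A, ∀ᶠ y in nhds x, g y = g x) {x y : X} (hx : x ∈ A) (hy : y ∈ A) :
    g x = g y := by
  have : IsLocallyConstant (fun z : A => g z) :=
    (IsLocallyConstant.iff_eventually_eq _).2 fun z =>
      continuous_subtype_val.continuousAt.eventually (hg z z.2)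
  have hp : PreconnectedSpace A := isPreconnected_iff_preconnectedSpace.1 hA
  exact this.apply_eq_of_preconnectedSpace ⟨x, hx⟩ ⟨y, hy⟩

/-- The strip of all points whose second coordinate lies in `I`. -/
def strip (I : Set ℝ) : Set Plane := {y | y 1 ∈ I}

lemma strip_eq (I : Set ℝ) : strip I = (EuclideanSpace.proj 1 : Plane →L[ℝ] ℝ) ⁻¹' I := rfl

lemma convex_strip {I : Set ℝ} (hI : Convex ℝ I) : Convex ℝ (strip I) := by
  rw [strip_eq]
  exact hI.linear_preimage (EuclideanSpace.proj 1 : Plane →L[ℝ] ℝ).toLinearMap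

lemma isOpen_strip {I : Set ℝ} (hI : IsOpen I) : IsOpen (strip I) :=
  hI.preimage (EuclideanSpace.proj 1 : Plane →L[ℝ] ℝ).continuous

lemma continuous_coord (j : Fin 2) : Continuous fun y : Plane => y j :=
  (EuclideanSpace.proj j : Plane →L[ℝ] ℝ).continuous

namespace SmoothObject

variable (B : SmoothObject)

lemma collarMap_image_mem_nhds {y : Plane} (hy : B.collarJacobian y ≠ 0) {U : Set Plane}
    (hU : U ∈ nhds y) : B.collarMap '' U ∈ nhds (B.collarMap y) := by
  obtain ⟨e, he, hez, -⟩ := B.exists_local_inverse hy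
  have := e.image_mem_nhds he hU
  rw [hez] at this
  convert this using 2
  exact (hez _).symm

end SmoothObject

namespace Suspension

variable {N : ℕ} {S : Suspension N}

lemma mem_solid {x : Plane} :
    x ∈ S.solid ↔ ∃ j m₁ m₂, x + S.shift m₁ m₂ ∈ (S.object j).body := Iff.rfl

lemma add_shift_mem_solid {x : Plane} (m₁ m₂ : ℤ) : x + S.shift m₁ m₂ ∈ S.solid ↔ x ∈ S.solid := by
  rw [mem_solid, mem_solid]
  constructor
  · rintro ⟨j, n₁, n₂, h⟩
    exact ⟨j, m₁ + n₁, m₂ + n₂, by rwa [shift_add, ← add_assoc]⟩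
  · rintro ⟨j, n₁, n₂, h⟩
    refine ⟨j, -m₁ + n₁, -m₂ + n₂, ?_⟩
    rw [shift_add, shift_neg]
    convert h using 1
    abel

lemma add_shift_mem_closedFluid {x : Plane} (m₁ m₂ : ℤ) :
    x + S.shift m₁ m₂ ∈ S.closedFluid ↔ x ∈ S.closedFluid :=
  not_congr (add_shift_mem_solid m₁ m₂)

/-- Local finiteness lets closures, and closedness, pass through the infinite union of translates.
-/
lemma locallyFinite_translates {K : Fin N → Set Plane} (hK : ∀ i, Bornology.IsBounded (K i)) :
    LocallyFinite fun q : Fin N × ℤ × ℤ => {x | x + S.shift q.2.1 q.2.2 ∈ K q.1} := by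
  intro x
  have : ∀ i, ∃ C : ℝ, ∀ z ∈ K i, ‖z‖ ≤ C := fun i => (hK i).exists_norm_le
  choose C hC using this
  refine ⟨Metric.ball x 1, Metric.ball_mem_nhds x one_pos, ?_⟩
  refine (Set.finite_univ.prod (S.finite_shift_le (∑ i, |C i| + ‖x‖ + 1))).subset ?_
  rintro ⟨i, m₁, m₂⟩ ⟨z, hz, hzx⟩
  refine ⟨Set.mem_univ _, ?_⟩
  have h1 := hC i _ hz
  have h2 := Finset.single_le_sum (f := fun i => |C i|) (fun i _ => abs_nonneg _)
    (Finset.mem_univ i)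
  have h3 : ‖z - x‖ < 1 := by simpa [dist_eq_norm] using hzx
  have h4 : S.shift m₁ m₂ = (z + S.shift m₁ m₂) - (z - x) - x := by abel
  change ‖S.shift m₁ m₂‖ ≤ _
  rw [h4]
  have h5 := norm_sub_le ((z + S.shift m₁ m₂) - (z - x)) x
  have h6 := norm_sub_le (z + S.shift m₁ m₂) (z - x)
  have h7 := le_abs_self (C i)
  simp only at h1 h2
  linarith

lemma mem_closure_solid {x : Plane} :
    x ∈ closure S.solid ↔ ∃ j m₁ m₂, x + S.shift m₁ m₂ ∈ closure (S.object j).body := by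
  have h : S.solid = ⋃ q : Fin N × ℤ × ℤ, {x | x + S.shift q.2.1 q.2.2 ∈ (S.object q.1).body} := by
    ext x; simp [mem_solid]
  rw [h, (locallyFinite_translates fun i => (S.object i).isBounded_body).closure_iUnion]
  have h2 : ∀ q : Fin N × ℤ × ℤ, closure {x | x + S.shift q.2.1 q.2.2 ∈ (S.object q.1).body} =
      {x | x + S.shift q.2.1 q.2.2 ∈ closure (S.object q.1).body} := fun q =>
    ((Homeomorph.addRight (S.shift q.2.1 q.2.2)).preimage_closure (S.object q.1).body).symm
  simp [h2]

lemma mem_fluid {x : Plane} :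
    x ∈ S.fluid ↔ ∀ j m₁ m₂, x + S.shift m₁ m₂ ∉ closure (S.object j).body := by
  simp [fluid, mem_closure_solid]

lemma isOpen_fluid : IsOpen S.fluid := isClosed_closure.isOpen_compl

lemma isOpen_solid : IsOpen S.solid := by
  have h : S.solid = ⋃ q : Fin N × ℤ × ℤ, {x | x + S.shift q.2.1 q.2.2 ∈ (S.object q.1).body} := by
    ext x; simp [mem_solid]
  rw [h]
  exact isOpen_iUnion fun q => (S.object q.1).isOpen_body.preimage (by fun_prop)

lemma fluid_subset_closedFluid : S.fluid ⊆ S.closedFluid :=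
  Set.compl_subset_compl.2 subset_closure

lemma add_shift_mem_fluid {x : Plane} (m₁ m₂ : ℤ) : x + S.shift m₁ m₂ ∈ S.fluid ↔ x ∈ S.fluid := by
  rw [mem_fluid, mem_fluid]
  constructor
  · intro h j n₁ n₂ hx
    refine h j (-m₁ + n₁) (-m₂ + n₂) ?_
    rw [shift_add, shift_neg]
    convert hx using 1
    abel
  · intro h j n₁ n₂ hx
    exact h j (m₁ + n₁) (m₂ + n₂) (by rwa [shift_add, ← add_assoc])

/-- A point lies in at most one closed translate. -/
lemma eq_of_mem_closure {x : Plane} {i j : Fin N} {m₁ m₂ n₁ n₂ : ℤ}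
    (h : x + S.shift m₁ m₂ ∈ closure (S.object i).body)
    (h' : x + S.shift n₁ n₂ ∈ closure (S.object j).body) : i = j ∧ m₁ = n₁ ∧ m₂ = n₂ := by
  by_contra hne
  have hd := S.disjoint_translates i j (n₁ - m₁) (n₂ - m₂) (by
    intro he
    simp only [Prod.mk.injEq] at he
    exact hne ⟨he.1, by omega, by omega⟩)
  refine Set.disjoint_left.1 hd ⟨_, h, ?_⟩ h'
  change x + S.shift m₁ m₂ + S.shift (n₁ - m₁) (n₂ - m₂) = _
  rw [add_assoc, ← shift_add]
  congr 2 <;> ring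

lemma mem_fluid_or_eq_curve {x : Plane} (hx : x ∈ S.closedFluid) :
    x ∈ S.fluid ∨ ∃ i m₁ m₂ t, x + S.shift m₁ m₂ = (S.object i).curve t := by
  by_cases h : x ∈ S.fluid
  · exact Or.inl h
  · right
    obtain ⟨i, m₁, m₂, hi⟩ := mem_closure_solid.1 (not_not.1 h)
    have : x + S.shift m₁ m₂ ∈ frontier (S.object i).body := by
      refine ⟨hi, fun hb => ?_⟩
      rw [(S.object i).isOpen_body.interior_eq] at hb
      exact hx ⟨i, m₁, m₂, hb⟩
    rw [(S.object i).frontier_body] at this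
    obtain ⟨t, ht⟩ := this
    exact ⟨i, m₁, m₂, t, ht.symm⟩

lemma curve_mem_closedFluid (i : Fin N) (t : ℝ) : (S.object i).curve t ∈ S.closedFluid := by
  rintro ⟨j, m₁, m₂, h⟩
  have h0 : (S.object i).curve t + S.shift 0 0 ∈ closure (S.object i).body := by
    simpa using (S.object i).curve_mem_closure t
  obtain ⟨rfl, rfl, rfl⟩ := eq_of_mem_closure h0 (subset_closure h)
  change (S.object i).curve t + S.shift 0 0 ∈ _ at h
  rw [shift_zero, add_zero] at h
  have := ((S.object i).curve_mem_frontier t).2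
  rw [(S.object i).isOpen_body.interior_eq] at this
  exact this h

end Suspension

/-! ### The two sides of the collars. -/

namespace Suspension.IsCollarWidth

variable {N : ℕ} {S : Suspension N} {δ : ℝ}

lemma collarMap_ne_curve (hδ : S.IsCollarWidth δ) {i j : Fin N} {m₁ m₂ : ℤ} {y : Plane}
    (hy : |y 1| < δ) (h0 : y 1 ≠ 0 ∨ (i, m₁, m₂) ≠ (j, 0, 0)) (t : ℝ) :
    (S.object i).collarMap y + S.shift m₁ m₂ ≠ (S.object j).curve t := by
  intro h
  rw [← SmoothObject.collarMap_point_zero] at h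
  obtain ⟨h1, h2, h3, h4, -⟩ := hδ.injective i j m₁ m₂ y _ hy (by simpa using hδ.pos) h
  rcases h0 with h0 | h0
  · exact h0 (by simpa using h4.symm)
  · exact h0 (by rw [h1, h2, h3])

/-- The inner collar lies in the object. -/
lemma collarMap_mem_body (hδ : S.IsCollarWidth δ) (i : Fin N) {y : Plane} (h1 : -δ < y 1)
    (h2 : y 1 < 0) : (S.object i).collarMap y ∈ (S.object i).body := by
  have hA : IsPreconnected ((S.object i).collarMap '' strip (Set.Ioo (-δ) 0)) :=
    (convex_strip (convex_Ioo _ _)).isPreconnected.image _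
      (S.object i).continuous_collarMap.continuousOn
  refine hA.subset_of_disjoint_frontier (S.object i).isOpen_body ?_ ?_ ⟨y, ⟨h1, h2⟩, rfl⟩
  -- The orientation at one parameter is enough, since the inner collar is connected and misses the
  -- frontier.
  · have hs : ∀ᶠ s in nhdsWithin (0 : ℝ) (Set.Ioi 0), s ∈ Set.Ioo 0 δ :=
      Ioo_mem_nhdsGT hδ.pos
    obtain ⟨s, hs1, hs2⟩ := (hs.and ((S.object i).positively_oriented 0)).exists
    refine ⟨_, ⟨point 0 (-s), ⟨by simpa using hs1.2, by simpa using hs1.1⟩, rfl⟩, ?_⟩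
    simpa [SmoothObject.collarMap] using hs2
  · rintro _ ⟨z, hz, rfl⟩ hf
    rw [(S.object i).frontier_body] at hf
    obtain ⟨t, ht⟩ := hf
    refine hδ.collarMap_ne_curve (i := i) (j := i) (m₁ := 0) (m₂ := 0) (y := z) ?_
      (Or.inl hz.2.ne) t (by simpa using ht.symm)
    exact abs_lt.2 ⟨hz.1, hz.2.trans hδ.pos⟩

lemma collarMap_image_mem_nhds (hδ : S.IsCollarWidth δ) (i : Fin N) {y : Plane} (hy : |y 1| < δ)
    {U : Set Plane} (hU : U ∈ nhds y) :
    (S.object i).collarMap '' U ∈ nhds ((S.object i).collarMap y) :=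
  (S.object i).collarMap_image_mem_nhds (hδ.jacobian_neg i y hy).ne hU

/-- The outer collar does not meet the object. -/
lemma collarMap_notMem_body (hδ : S.IsCollarWidth δ) (i : Fin N) {y : Plane} (h1 : 0 < y 1)
    (h2 : y 1 < δ) : (S.object i).collarMap y ∉ (S.object i).body := by
  intro hy
  have hA : IsPreconnected ((S.object i).collarMap '' strip (Set.Ioo 0 δ)) :=
    (convex_strip (convex_Ioo _ _)).isPreconnected.image _
      (S.object i).continuous_collarMap.continuousOn
  have hsub : (S.object i).collarMap '' strip (Set.Ioo 0 δ) ⊆ (S.object i).body := by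
    refine hA.subset_of_disjoint_frontier (S.object i).isOpen_body
      ⟨_, ⟨y, ⟨h1, h2⟩, rfl⟩, hy⟩ ?_
    rintro _ ⟨z, hz, rfl⟩ hf
    rw [(S.object i).frontier_body] at hf
    obtain ⟨t, ht⟩ := hf
    refine hδ.collarMap_ne_curve (i := i) (j := i) (m₁ := 0) (m₂ := 0) (y := z) ?_
      (Or.inl hz.1.ne') t (by simpa using ht.symm)
    exact abs_lt.2 ⟨by linarith [hz.1, hδ.pos], hz.2⟩
  -- With the outer collar also inside the body, both sides of every boundary point would lie in the
  -- closure. The closure would be clopen, hence the plane, against boundedness.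
  have hopen : IsOpen (closure (S.object i).body) := by
    refine isOpen_iff_mem_nhds.2 fun x hx => ?_
    by_cases hxb : x ∈ (S.object i).body
    · exact Filter.mem_of_superset ((S.object i).isOpen_body.mem_nhds hxb) subset_closure
    · have hf : x ∈ frontier (S.object i).body :=
        ⟨hx, by rwa [(S.object i).isOpen_body.interior_eq]⟩
      rw [(S.object i).frontier_body] at hf
      obtain ⟨t, rfl⟩ := hf
      rw [← SmoothObject.collarMap_point_zero]
      refine Filter.mem_of_superset (hδ.collarMap_image_mem_nhds i (by simpa using hδ.pos)
        ((isOpen_strip isOpen_Ioo).mem_nhds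
          (show point t 0 ∈ strip (Set.Ioo (-δ) δ) by simp [strip, hδ.pos]))) ?_
      rintro _ ⟨z, hz, rfl⟩
      rcases lt_trichotomy (z 1) 0 with h | h | h
      · exact subset_closure (hδ.collarMap_mem_body i hz.1 h)
      · rw [← point_coords z, h, SmoothObject.collarMap_point_zero]
        exact (S.object i).curve_mem_closure _
      · exact subset_closure (hsub ⟨z, ⟨h, hz.2⟩, rfl⟩)
  have huniv := (isClopen_iff.1 ⟨isClosed_closure, hopen⟩).resolve_left
    (Set.Nonempty.ne_empty ⟨_, subset_closure hy⟩)
  have hb := (S.object i).isBounded_body.closure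
  rw [huniv] at hb
  exact NormedSpace.unbounded_univ ℝ Plane hb

/-- The outer collar lies in the fluid. -/
lemma collarMap_mem_fluid (hδ : S.IsCollarWidth δ) (i : Fin N) {y : Plane} (h1 : 0 < y 1)
    (h2 : y 1 < δ) : (S.object i).collarMap y ∈ S.fluid := by
  rw [mem_fluid]
  intro j m₁ m₂ hy
  have habs : ∀ z : Plane, 0 ≤ z 1 → z 1 < δ → |z 1| < δ := fun z a b => by
    rwa [abs_of_nonneg a]
  have hbody : (S.object i).collarMap y + S.shift m₁ m₂ ∈ (S.object j).body := by
    by_contra hb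
    have hf : (S.object i).collarMap y + S.shift m₁ m₂ ∈ frontier (S.object j).body :=
      ⟨hy, by rwa [(S.object j).isOpen_body.interior_eq]⟩
    rw [(S.object j).frontier_body] at hf
    obtain ⟨t, ht⟩ := hf
    exact hδ.collarMap_ne_curve (habs y h1.le h2) (Or.inl h1.ne') t ht.symm
  by_cases hij : (i, m₁, m₂) = (j, 0, 0)
  · simp only [Prod.mk.injEq] at hij
    obtain ⟨rfl, rfl, rfl⟩ := hij
    exact hδ.collarMap_notMem_body i h1 h2 (by simpa using hbody)
  -- The strip now includes `s = 0`: a different translate does not meet the frontier of object `j`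
  -- even there. The curve itself would then be inside object `j`, although it lies in the closed
  -- fluid.
  · have hA : IsPreconnected
        ((fun z => (S.object i).collarMap z + S.shift m₁ m₂) '' strip (Set.Ico 0 δ)) :=
      (convex_strip (convex_Ico _ _)).isPreconnected.image _
        ((S.object i).continuous_collarMap.add continuous_const).continuousOn
    have hsub := hA.subset_of_disjoint_frontier (S.object j).isOpen_body
      ⟨_, ⟨y, ⟨h1.le, h2⟩, rfl⟩, hbody⟩ (by
        rintro _ ⟨z, hz, rfl⟩ hf
        rw [(S.object j).frontier_body] at hf
        obtain ⟨t, ht⟩ := hf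
        exact hδ.collarMap_ne_curve (habs z hz.1 hz.2) (Or.inr hij) t ht.symm)
    have h0 := hsub ⟨point 0 0, by simp [strip, hδ.pos], rfl⟩
    simp only [SmoothObject.collarMap_point_zero] at h0
    exact curve_mem_closedFluid i 0 ⟨j, m₁, m₂, h0⟩

lemma collarMap_mem_closedFluid (hδ : S.IsCollarWidth δ) (i : Fin N) {y : Plane} (h1 : 0 ≤ y 1)
    (h2 : y 1 < δ) : (S.object i).collarMap y ∈ S.closedFluid := by
  rcases h1.eq_or_lt with h | h
  · rw [← point_coords y, ← h, SmoothObject.collarMap_point_zero]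
    exact curve_mem_closedFluid i _
  · exact fluid_subset_closedFluid (hδ.collarMap_mem_fluid i h h2)

end Suspension.IsCollarWidth

/-! ### Unique differentiability and connectedness of the fluid domain. -/

namespace Suspension

variable {N : ℕ} {S : Suspension N}

/-- At a boundary point the closed fluid contains the image of a half-open strip under a map with
invertible derivative, and the strip is convex with interior. Hence one-sided derivatives are
determined there, and the velocity gradient is continuous up to the boundary. -/
lemma uniqueDiffOn_closedFluid : UniqueDiffOn ℝ S.closedFluid := by
  obtain ⟨δ, hδ⟩ := S.exists_isCollarWidth
  intro x hx
  rcases mem_fluid_or_eq_curve hx with h | ⟨i, m₁, m₂, t, ht⟩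
  · exact (isOpen_fluid.uniqueDiffOn x h).mono fluid_subset_closedFluid
  · have hH : UniqueDiffWithinAt ℝ (strip (Set.Ico 0 δ)) (point t 0) := by
      refine uniqueDiffOn_convex (convex_strip (convex_Ico _ _)) ?_ _ (by simp [strip, hδ.pos])
      refine ⟨point 0 (δ / 2), mem_interior.2 ⟨strip (Set.Ioo 0 δ), fun z hz => ⟨hz.1.le, hz.2⟩,
        isOpen_strip isOpen_Ioo, ?_⟩⟩
      simp [strip, hδ.pos]
    have hd : HasFDerivWithinAt (fun z => (S.object i).collarMap z - S.shift m₁ m₂)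
        (fderiv ℝ (S.object i).collarMap (point t 0)) (strip (Set.Ico 0 δ)) (point t 0) :=
      (((S.object i).differentiable_collarMap _).hasFDerivAt.sub_const _).hasFDerivWithinAt
    have hdet : (fderiv ℝ (S.object i).collarMap (point t 0)).det ≠ 0 :=
      (hδ.jacobian_neg i (point t 0) (by simpa using hδ.pos)).ne
    have hr : DenseRange (fderiv ℝ (S.object i).collarMap (point t 0)) := by
      rw [← ContinuousLinearMap.coe_toContinuousLinearEquivOfDetNeZero _ hdet]
      exact (ContinuousLinearEquiv.surjective _).denseRange
    have := hd.uniqueDiffWithinAt hH hr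
    rw [SmoothObject.collarMap_point_zero, ← ht, add_sub_cancel_right] at this
    refine this.mono ?_
    rintro _ ⟨z, hz, rfl⟩
    rw [← add_shift_mem_closedFluid m₁ m₂, sub_add_cancel]
    exact hδ.collarMap_mem_closedFluid i hz.1 hz.2

/-- A function that is locally constant on the fluid and continuous up to the boundary takes one
value on each outer collar. -/
lemma IsCollarWidth.eq_on_outer_collar {δ : ℝ} (hδ : S.IsCollarWidth δ) {X : Type*}
    [TopologicalSpace X] [T2Space X] {f : Plane → X}
    (hloc : ∀ x ∈ S.fluid, ∀ᶠ y in nhds x, f y = f x) (hcont : ContinuousOn f S.closedFluid)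
    (i : Fin N) (m₁ m₂ : ℤ) {y z : Plane} (hy : y 1 ∈ Set.Ico 0 δ) (hz : z 1 ∈ Set.Ico 0 δ) :
    f ((S.object i).collarMap y - S.shift m₁ m₂) = f ((S.object i).collarMap z - S.shift m₁ m₂) := by
  set g : Plane → X := fun y => f ((S.object i).collarMap y - S.shift m₁ m₂) with hg
  have hc : Continuous fun y => (S.object i).collarMap y - S.shift m₁ m₂ :=
    (S.object i).continuous_collarMap.sub continuous_const
  have hin : ∀ y z : Plane, y 1 ∈ Set.Ioo 0 δ → z 1 ∈ Set.Ioo 0 δ → g y = g z := fun y z hy hz => by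
    refine (convex_strip (convex_Ioo 0 δ)).isPreconnected.eq_of_locally_constant
      (fun x hx => ?_) (x := y) (y := z) hy hz
    refine hc.continuousAt.eventually (hloc _ ?_)
    rw [← add_shift_mem_fluid m₁ m₂, sub_add_cancel]
    exact hδ.collarMap_mem_fluid i hx.1 hx.2
  have hmid : (point 0 (δ / 2)) 1 ∈ Set.Ioo 0 δ := by simp [hδ.pos]
  suffices h : ∀ y : Plane, y 1 ∈ Set.Ico 0 δ → g y = g (point 0 (δ / 2)) from
    (h y hy).trans (h z hz).symm
  intro y hy
  rcases hy.1.eq_or_lt with h0 | h0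
  · have ht : Filter.Tendsto (fun s => g (point (y 0) s)) (nhdsWithin 0 (Set.Ioo 0 δ))
        (nhds (g y)) := by
      have h1 : ContinuousWithinAt (fun s => g (point (y 0) s)) (Set.Ico 0 δ) 0 := by
        have hmaps : Set.MapsTo (fun s => (S.object i).collarMap (point (y 0) s) - S.shift m₁ m₂)
            (Set.Ico 0 δ) S.closedFluid := fun s hs => by
          rw [← add_shift_mem_closedFluid m₁ m₂, sub_add_cancel]
          exact hδ.collarMap_mem_closedFluid i (by simpa using hs.1) (by simpa using hs.2)
        refine ContinuousWithinAt.comp (hcont _ (hmaps (by simp [hδ.pos]))) ?_ hmaps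
        exact ((hc.comp continuous_point).comp (by fun_prop : Continuous fun s : ℝ =>
          (y 0, s))).continuousWithinAt
      have h2 := h1.mono Set.Ioo_subset_Ico_self
      have : point (y 0) 0 = y := by rw [h0, point_coords]
      simpa [ContinuousWithinAt, this] using h2
    have hconst : Filter.Tendsto (fun s => g (point (y 0) s)) (nhdsWithin 0 (Set.Ioo 0 δ))
        (nhds (g (point 0 (δ / 2)))) := by
      refine tendsto_const_nhds.congr' ?_
      filter_upwards [self_mem_nhdsWithin] with s hs
      exact hin _ _ hmid (by simpa using hs)
    have hne : (nhdsWithin (0 : ℝ) (Set.Ioo 0 δ)).NeBot := left_nhdsWithin_Ioo_neBot hδ.pos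
    exact tendsto_nhds_unique ht hconst
  · exact hin _ _ ⟨h0, hy.2⟩ hmid

/-- A function that is locally constant on the fluid and continuous up to the boundary is constant:
the fluid domain is connected. -/
theorem eq_of_locally_constant_on_fluid {X : Type*}
    [TopologicalSpace X] [T2Space X] {f : Plane → X}
    (hloc : ∀ x ∈ S.fluid, ∀ᶠ y in nhds x, f y = f x) (hcont : ContinuousOn f S.closedFluid)
    {x y : Plane} (hx : x ∈ S.closedFluid) (hy : y ∈ S.closedFluid) : f x = f y := by
  classical
  obtain ⟨δ, hδ⟩ := S.exists_isCollarWidth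
  -- The extension gives each closed translate the value of `f` at its own boundary point of
  -- parameter `0`; a point lies in at most one closed translate, so the choice is harmless.
  let g : Plane → X := fun x =>
    if h : ∃ q : Fin N × ℤ × ℤ, x + S.shift q.2.1 q.2.2 ∈ closure (S.object q.1).body then
      f ((S.object h.choose.1).curve 0 - S.shift h.choose.2.1 h.choose.2.2) else f x
  have g_closure : ∀ x i m₁ m₂, x + S.shift m₁ m₂ ∈ closure (S.object i).body →
      g x = f ((S.object i).curve 0 - S.shift m₁ m₂) := fun x i m₁ m₂ hx => by
    have h : ∃ q : Fin N × ℤ × ℤ, x + S.shift q.2.1 q.2.2 ∈ closure (S.object q.1).body :=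
      ⟨(i, m₁, m₂), hx⟩
    obtain ⟨h1, h2, h3⟩ := eq_of_mem_closure h.choose_spec hx
    simp only [g, dif_pos h]
    rw [h2, h3, h1]
  have g_fluid : ∀ x ∈ S.fluid, g x = f x := fun x hx => by
    have h : ¬ ∃ q : Fin N × ℤ × ℤ, x + S.shift q.2.1 q.2.2 ∈ closure (S.object q.1).body := by
      rintro ⟨q, hq⟩
      exact mem_fluid.1 hx _ _ _ hq
    simp only [g, dif_neg h]
  have f_collar : ∀ i m₁ m₂ (y : Plane), y 1 ∈ Set.Ico 0 δ →
      f ((S.object i).collarMap y - S.shift m₁ m₂) = f ((S.object i).curve 0 - S.shift m₁ m₂) :=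
    fun i m₁ m₂ y hy => by
      rw [← SmoothObject.collarMap_point_zero]
      exact hδ.eq_on_outer_collar hloc hcont i m₁ m₂ hy (by simp [hδ.pos])
  have g_eq : ∀ x ∈ S.closedFluid, g x = f x := fun x hx => by
    rcases mem_fluid_or_eq_curve hx with h | ⟨i, m₁, m₂, t, ht⟩
    · exact g_fluid x h
    · rw [g_closure x i m₁ m₂ (ht ▸ (S.object i).curve_mem_closure t),
        ← f_collar i m₁ m₂ (point t 0) (by simp [hδ.pos]), SmoothObject.collarMap_point_zero, ← ht,
        add_sub_cancel_right]
  have g_loc : IsLocallyConstant g := by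
    rw [IsLocallyConstant.iff_eventually_eq]
    intro x
    by_cases hs : x ∈ S.solid
    · obtain ⟨i, m₁, m₂, h⟩ := mem_solid.1 hs
      have hc : Continuous fun z => z + S.shift m₁ m₂ := by fun_prop
      filter_upwards [hc.continuousAt.eventually_mem ((S.object i).isOpen_body.mem_nhds h)] with z hz
      rw [g_closure z i m₁ m₂ (subset_closure hz), g_closure x i m₁ m₂ (subset_closure h)]
    · rcases mem_fluid_or_eq_curve hs with h | ⟨i, m₁, m₂, t, ht⟩
      · filter_upwards [hloc x h, isOpen_fluid.mem_nhds h] with z hz hzf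
        rw [g_fluid z hzf, hz, g_fluid x h]
      -- Collar coordinates cover a neighbourhood of a boundary point. For `s < 0` the value is the
      -- one assigned to the translate; for `s ≥ 0` it is the constant value of `f` on the outer
      -- collar.
      · have hn := hδ.collarMap_image_mem_nhds i (y := point t 0) (by simpa using hδ.pos)
          ((isOpen_strip isOpen_Ioo).mem_nhds
            (show point t 0 ∈ strip (Set.Ioo (-δ) δ) by simp [strip, hδ.pos]))
        rw [SmoothObject.collarMap_point_zero, ← ht] at hn
        have hc : Continuous fun z => z + S.shift m₁ m₂ := by fun_prop
        filter_upwards [hc.continuousAt.eventually_mem hn] with z hz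
        rw [g_closure x i m₁ m₂ (ht ▸ (S.object i).curve_mem_closure t)]
        obtain ⟨w, hw, hwz⟩ := hz
        rcases lt_or_ge (w 1) 0 with h0 | h0
        · refine g_closure z i m₁ m₂ (subset_closure ?_)
          rw [← hwz]
          exact hδ.collarMap_mem_body i hw.1 h0
        · have hzw : z = (S.object i).collarMap w - S.shift m₁ m₂ := by
            rw [hwz, add_sub_cancel_right]
          rw [g_eq, hzw, f_collar i m₁ m₂ w ⟨h0, hw.2⟩]
          rw [← add_shift_mem_closedFluid m₁ m₂, ← hwz]
          exact hδ.collarMap_mem_closedFluid i h0 hw.2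
  rw [← g_eq x hx, ← g_eq y hy]
  exact g_loc.apply_eq_of_preconnectedSpace x y

end Suspension

/-! ### Cutoff functions of the transverse coordinate. -/

/-- A smooth function that vanishes for `s ≤ b / 2` and is one for `s ≥ b`. -/
def profile (b s : ℝ) : ℝ := Real.smoothTransition (2 * s / b - 1)

lemma contDiff_profile (b : ℝ) {n : ℕ∞} : ContDiff ℝ n (profile b) := by
  have h : ContDiff ℝ n fun s : ℝ => 2 * s / b - 1 := by fun_prop
  exact Real.smoothTransition.contDiff.comp h

lemma profile_eq_zero {b s : ℝ} (hb : 0 < b) (h : s ≤ b / 2) : profile b s = 0 := by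
  refine Real.smoothTransition.zero_of_nonpos ?_
  rw [sub_nonpos, div_le_one hb]; linarith

lemma profile_eq_one {b s : ℝ} (hb : 0 < b) (h : b ≤ s) : profile b s = 1 := by
  refine Real.smoothTransition.one_of_one_le ?_
  have : 2 ≤ 2 * s / b := by rw [le_div_iff₀ hb]; linarith
  linarith

lemma profile_nonneg (b s : ℝ) : 0 ≤ profile b s := Real.smoothTransition.nonneg _

lemma monotone_profile {b : ℝ} (hb : 0 < b) : Monotone (profile b) := by
  intro s t h
  refine Real.smoothTransition.monotone ?_
  gcongr

lemma deriv_profile_nonneg {b : ℝ} (hb : 0 < b) (s : ℝ) : 0 ≤ deriv (profile b) s :=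
  (monotone_profile hb).deriv_nonneg

lemma profile_anti {b c : ℝ} (hb : 0 < b) (hbc : b ≤ c) (s : ℝ) : profile c s ≤ profile b s := by
  rcases le_total s 0 with h | h
  · rw [profile_eq_zero (hb.trans_le hbc) (by linarith)]
    exact profile_nonneg _ _
  · refine Real.smoothTransition.monotone ?_
    gcongr

namespace Suspension

variable {N : ℕ} (S : Suspension N)

/-- `y` gives collar coordinates of `x` with respect to a translate of one of the objects. -/
def IsCollarCoord (δ : ℝ) (x y : Plane) : Prop :=
  |y 1| < δ ∧ ∃ i m₁ m₂, x + S.shift m₁ m₂ = (S.object i).collarMap y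

open Classical in
/-- The cutoff function that vanishes in the objects and near their boundaries, and is one outside
of the outer collars of width `b`. -/
def cutoff (δ b : ℝ) (x : Plane) : ℝ :=
  if h : ∃ y, S.IsCollarCoord δ x y then profile b (h.choose 1)
  else if x ∈ S.solid then 0 else 1

variable {S}

namespace IsCollarWidth

variable {δ b : ℝ}

/-- The tangential coordinate is unique only up to periods, but `cutoff` uses only the transverse
one, so its choice of coordinates does not matter. -/
lemma isCollarCoord_unique (hδ : S.IsCollarWidth δ) {x y z : Plane} (hy : S.IsCollarCoord δ x y)
    (hz : S.IsCollarCoord δ x z) : z 1 = y 1 := by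
  obtain ⟨hy1, i, m₁, m₂, hy⟩ := hy
  obtain ⟨hz1, j, n₁, n₂, hz⟩ := hz
  refine (hδ.injective i j (n₁ - m₁) (n₂ - m₂) y z hy1 hz1 ?_).2.2.2.1
  rw [← hy, ← hz, add_assoc, ← shift_add]
  congr 2 <;> ring

lemma cutoff_eq (hδ : S.IsCollarWidth δ) {x y : Plane} (hy : S.IsCollarCoord δ x y) :
    S.cutoff δ b x = profile b (y 1) := by
  have h : ∃ y, S.IsCollarCoord δ x y := ⟨y, hy⟩
  rw [cutoff, dif_pos h, hδ.isCollarCoord_unique hy h.choose_spec]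

lemma cutoff_collarMap (hδ : S.IsCollarWidth δ) (i : Fin N) {y : Plane} (hy : |y 1| < δ) :
    S.cutoff δ b ((S.object i).collarMap y) = profile b (y 1) :=
  hδ.cutoff_eq ⟨hy, i, 0, 0, by simp⟩

lemma coord_neg_of_mem_solid (hδ : S.IsCollarWidth δ) {x y : Plane} (hx : x ∈ S.solid)
    (hy : S.IsCollarCoord δ x y) : y 1 < 0 := by
  obtain ⟨hy1, i, m₁, m₂, hy⟩ := hy
  by_contra! h
  have := hδ.collarMap_mem_closedFluid i h (lt_of_abs_lt hy1)
  rw [← hy, add_shift_mem_closedFluid] at this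
  exact this hx

lemma coord_pos_of_mem_fluid (hδ : S.IsCollarWidth δ) {x y : Plane} (hx : x ∈ S.fluid)
    (hy : S.IsCollarCoord δ x y) : 0 < y 1 := by
  obtain ⟨hy1, i, m₁, m₂, hy⟩ := hy
  by_contra! h
  refine mem_fluid.1 hx i m₁ m₂ ?_
  rw [hy]
  rcases h.eq_or_lt with h | h
  · rw [← point_coords y, h, SmoothObject.collarMap_point_zero]
    exact (S.object i).curve_mem_closure _
  · exact subset_closure (hδ.collarMap_mem_body i (abs_lt.1 hy1).1 h)

lemma cutoff_of_mem_solid (hδ : S.IsCollarWidth δ) (hb : 0 < b) {x : Plane} (hx : x ∈ S.solid) :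
    S.cutoff δ b x = 0 := by
  by_cases h : ∃ y, S.IsCollarCoord δ x y
  · obtain ⟨y, hy⟩ := h
    rw [hδ.cutoff_eq hy, profile_eq_zero hb]
    linarith [hδ.coord_neg_of_mem_solid hx hy]
  · rw [cutoff, dif_neg h, if_pos hx]

lemma cutoff_of_mem_fluid (hδ : S.IsCollarWidth δ) (hb : 0 < b) {x : Plane} (hx : x ∈ S.fluid)
    (h : ∀ y, S.IsCollarCoord δ x y → b ≤ |y 1|) : S.cutoff δ b x = 1 := by
  by_cases h' : ∃ y, S.IsCollarCoord δ x y
  · obtain ⟨y, hy⟩ := h'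
    rw [hδ.cutoff_eq hy, profile_eq_one hb]
    simpa [abs_of_pos (hδ.coord_pos_of_mem_fluid hx hy)] using h y hy
  · rw [cutoff, dif_neg h', if_neg (fluid_subset_closedFluid hx)]

lemma cutoff_nonneg (b : ℝ) (x : Plane) : 0 ≤ S.cutoff δ b x := by
  unfold cutoff
  split_ifs
  · exact profile_nonneg _ _
  · exact le_rfl
  · exact zero_le_one

lemma cutoff_anti {c : ℝ} (hb : 0 < b) (hbc : b ≤ c) (x : Plane) :
    S.cutoff δ c x ≤ S.cutoff δ b x := by
  unfold cutoff
  split_ifs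
  · exact profile_anti hb hbc _
  · exact le_rfl
  · exact le_rfl

lemma isCollarCoord_add_shift {x y : Plane} (m₁ m₂ : ℤ) :
    S.IsCollarCoord δ (x + S.shift m₁ m₂) y ↔ S.IsCollarCoord δ x y := by
  refine and_congr_right fun _ => exists_congr fun i => ⟨?_, ?_⟩
  · rintro ⟨n₁, n₂, h⟩
    exact ⟨m₁ + n₁, m₂ + n₂, by rwa [shift_add, ← add_assoc]⟩
  · rintro ⟨n₁, n₂, h⟩
    refine ⟨-m₁ + n₁, -m₂ + n₂, ?_⟩
    rw [shift_add, shift_neg, ← h]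
    abel

lemma cutoff_add_shift (hδ : S.IsCollarWidth δ) (x : Plane) (m₁ m₂ : ℤ) :
    S.cutoff δ b (x + S.shift m₁ m₂) = S.cutoff δ b x := by
  classical
  by_cases h : ∃ y, S.IsCollarCoord δ x y
  · obtain ⟨y, hy⟩ := h
    rw [hδ.cutoff_eq hy, hδ.cutoff_eq ((isCollarCoord_add_shift m₁ m₂).2 hy)]
  · have h' : ¬ ∃ y, S.IsCollarCoord δ (x + S.shift m₁ m₂) y := by
      simpa only [isCollarCoord_add_shift] using h
    rw [cutoff, cutoff, dif_neg h, dif_neg h']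
    exact if_congr (add_shift_mem_solid m₁ m₂) rfl rfl

lemma eventually_isCollarCoord (hδ : S.IsCollarWidth δ) {i : Fin N} {m₁ m₂ : ℤ} {x y : Plane}
    (hy : |y 1| < δ) (hx : x + S.shift m₁ m₂ = (S.object i).collarMap y) {U : Set Plane}
    (hU : U ∈ nhds y) : ∀ᶠ z in nhds x, ∃ w ∈ U, S.IsCollarCoord δ z w := by
  have hV : U ∩ strip (Set.Ioo (-δ) δ) ∈ nhds y :=
    Filter.inter_mem hU ((isOpen_strip isOpen_Ioo).mem_nhds (abs_lt.1 hy))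
  have hn := hδ.collarMap_image_mem_nhds i hy hV
  rw [← hx] at hn
  have hc : Continuous fun z => z + S.shift m₁ m₂ := by fun_prop
  filter_upwards [hc.continuousAt.eventually_mem hn] with z hz
  obtain ⟨w, hw, hwz⟩ := hz
  exact ⟨w, hw.1, abs_lt.2 hw.2, i, m₁, m₂, hwz.symm⟩

/-- The cutoff function vanishes near every point that is not in the open fluid domain. -/
lemma cutoff_eventually_zero (hδ : S.IsCollarWidth δ) (hb : 0 < b) {x : Plane}
    (hx : x ∉ S.fluid) : S.cutoff δ b =ᶠ[nhds x] fun _ => 0 := by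
  by_cases hs : x ∈ S.solid
  · filter_upwards [isOpen_solid.mem_nhds hs] with z hz
    exact hδ.cutoff_of_mem_solid hb hz
  · obtain ⟨i, m₁, m₂, t, ht⟩ := (mem_fluid_or_eq_curve hs).resolve_left hx
    rw [← SmoothObject.collarMap_point_zero] at ht
    filter_upwards [hδ.eventually_isCollarCoord (by simpa using hδ.pos) ht
      ((isOpen_strip (isOpen_Iio (a := b / 2))).mem_nhds
        (show point t 0 ∈ strip (Set.Iio (b / 2)) by simp [strip, hb]))] with z hz
    obtain ⟨w, hw, hzw⟩ := hz
    rw [hδ.cutoff_eq hzw, profile_eq_zero hb (le_of_lt hw)]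

/-- One period of each collar is compact and the translates are locally finite. The open complement
is where the cutoff is locally one in the fluid. -/
lemma isClosed_collar (b : ℝ) :
    IsClosed {x | ∃ y : Plane, |y 1| ≤ b ∧ ∃ i m₁ m₂,
      x + S.shift m₁ m₂ = (S.object i).collarMap y} := by
  let K : Fin N → Set Plane := fun i =>
    (fun q : ℝ × ℝ => (S.object i).collarMap (point q.1 q.2)) ''
      (Set.Icc 0 (2 * Real.pi) ×ˢ Set.Icc (-b) b)
  have hK : ∀ i, IsCompact (K i) := fun i => (isCompact_Icc.prod isCompact_Icc).image
    ((S.object i).continuous_collarMap.comp continuous_point)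
  have h : {x | ∃ y : Plane, |y 1| ≤ b ∧ ∃ i m₁ m₂,
      x + S.shift m₁ m₂ = (S.object i).collarMap y} =
      ⋃ q : Fin N × ℤ × ℤ, {x | x + S.shift q.2.1 q.2.2 ∈ K q.1} := by
    ext x
    rw [Set.mem_iUnion]
    constructor
    · rintro ⟨y, hy, i, m₁, m₂, hx⟩
      obtain ⟨k, t, ht, hyt⟩ := SmoothObject.exists_collar_shift y
      refine ⟨(i, m₁, m₂), (t, y 1), ⟨ht, abs_le.1 hy⟩, ?_⟩
      change (S.object i).collarMap (point t (y 1)) = x + S.shift m₁ m₂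
      rw [hx, hyt, SmoothObject.collarMap_add_period]
      simp
    · rintro ⟨⟨i, m₁, m₂⟩, ⟨t, s⟩, ⟨ht, hs⟩, hx⟩
      exact ⟨point t s, by simpa using abs_le.2 hs, i, m₁, m₂, hx.symm⟩
  rw [h]
  exact (locallyFinite_translates fun i => (hK i).isBounded).isClosed_iUnion fun q =>
    (hK q.1).isClosed.preimage (by fun_prop)

/-- The cutoff function is one near every point of the fluid outside of the collars of
width `b`. -/
lemma cutoff_eventually_one (hδ : S.IsCollarWidth δ) (hb : 0 < b) (hbδ : b < δ) {x : Plane}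
    (hx : x ∈ S.fluid) (h : ∀ y, S.IsCollarCoord δ x y → b < y 1) :
    S.cutoff δ b =ᶠ[nhds x] fun _ => 1 := by
  have hn : x ∈ ({x | ∃ y : Plane, |y 1| ≤ b ∧ ∃ i m₁ m₂,
      x + S.shift m₁ m₂ = (S.object i).collarMap y} : Set Plane)ᶜ := by
    rintro ⟨y, hy, hx⟩
    exact absurd (h y ⟨hy.trans_lt hbδ, hx⟩) (not_lt.2 ((le_abs_self _).trans hy))
  filter_upwards [(isClosed_collar b).isOpen_compl.mem_nhds hn, isOpen_fluid.mem_nhds hx]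
    with z hz hzf
  refine hδ.cutoff_of_mem_fluid hb hzf fun y hy => ?_
  by_contra! hlt
  exact hz ⟨y, hlt.le, hy.2⟩

/-- Where collar coordinates exist, a smooth local inverse writes the cutoff as the profile of the
transverse coordinate. Elsewhere the cutoff is locally constant. -/
lemma contDiff_cutoff (hδ : S.IsCollarWidth δ) (hb : 0 < b) (hbδ : b < δ) :
    ContDiff ℝ 1 (S.cutoff δ b) := by
  rw [contDiff_iff_contDiffAt]
  intro x
  by_cases hx : x ∈ S.fluid
  · by_cases h : ∃ y, S.IsCollarCoord δ x y
    · obtain ⟨y, hy, i, m₁, m₂, hxy⟩ := h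
      obtain ⟨e, he, hez, hes⟩ := (S.object i).exists_local_inverse (hδ.jacobian_neg i y hy).ne
      rw [← hxy] at hes
      have hsh : ContDiffAt ℝ 1 (fun z => z + S.shift m₁ m₂) x := by fun_prop
      have h1 : ContDiffAt ℝ 1 (fun z => profile b ((e.symm (z + S.shift m₁ m₂)) 1)) x := by
        have h2 : ContDiffAt ℝ 1 (fun z => e.symm (z + S.shift m₁ m₂)) x :=
          ContDiffAt.comp x (f := fun z => z + S.shift m₁ m₂) (g := e.symm)
            (hes.of_le (by exact_mod_cast le_top)) hsh
        exact (contDiff_profile b (n := 1)).contDiffAt.comp x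
          ((SmoothObject.contDiff_coord 1).contDiffAt.comp x h2)
      refine h1.congr_of_eventuallyEq ?_
      have htarget : x + S.shift m₁ m₂ ∈ e.target := by
        rw [hxy, ← hez]; exact e.map_source he
      have hsy : e.symm (x + S.shift m₁ m₂) = y := by
        rw [hxy, ← hez, e.left_inv he]
      have hc : ContinuousAt (fun z => e.symm (z + S.shift m₁ m₂)) x :=
        ContinuousAt.comp (f := fun z => z + S.shift m₁ m₂) (g := e.symm)
          (e.continuousAt_symm htarget) hsh.continuousAt
      have hev : ∀ᶠ z in nhds x, e.symm (z + S.shift m₁ m₂) ∈ strip (Set.Ioo (-δ) δ) :=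
        hc.eventually_mem ((isOpen_strip isOpen_Ioo).mem_nhds (by
          rw [hsy]; exact abs_lt.1 hy))
      filter_upwards [hev, hsh.continuousAt.eventually_mem (e.open_target.mem_nhds htarget)]
        with z hz hzt
      refine hδ.cutoff_eq ⟨abs_lt.2 hz, i, m₁, m₂, ?_⟩
      rw [← hez, e.right_inv hzt]
    · exact contDiffAt_const.congr_of_eventuallyEq (hδ.cutoff_eventually_one hb hbδ hx
        fun y hy => absurd ⟨y, hy⟩ h)
  · exact contDiffAt_const.congr_of_eventuallyEq (hδ.cutoff_eventually_zero hb hx)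

lemma fderiv_cutoff_eq_zero (hδ : S.IsCollarWidth δ) (hb : 0 < b) (hbδ : b < δ) {x : Plane}
    (h : ∀ y, S.IsCollarCoord δ x y → 0 < y 1 → b < y 1) : fderiv ℝ (S.cutoff δ b) x = 0 := by
  by_cases hx : x ∈ S.fluid
  · rw [(hδ.cutoff_eventually_one hb hbδ hx fun y hy =>
      h y hy (hδ.coord_pos_of_mem_fluid hx hy)).fderiv_eq]
    simp
  · rw [(hδ.cutoff_eventually_zero hb hx).fderiv_eq]
    simp

lemma fderiv_cutoff_collarMap (hδ : S.IsCollarWidth δ) (hb : 0 < b) (hbδ : b < δ) (i : Fin N)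
    {y : Plane} (hy : |y 1| < δ) (w : Plane) :
    fderiv ℝ (S.cutoff δ b) ((S.object i).collarMap y) (fderiv ℝ (S.object i).collarMap y w) =
      deriv (profile b) (y 1) * w 1 := by
  have h1 : HasFDerivAt (fun z => S.cutoff δ b ((S.object i).collarMap z)) _ y :=
    (((hδ.contDiff_cutoff hb hbδ).differentiable (by simp) _).hasFDerivAt).comp y
      ((S.object i).differentiable_collarMap y).hasFDerivAt
  have h2 : HasFDerivAt (fun z : Plane => profile b (z 1)) _ y :=
    (((contDiff_profile b (n := 1)).differentiable (by simp) (y 1)).hasDerivAt).comp_hasFDerivAt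
      (h₂ := profile b) (f := fun z : Plane => z 1) y
      (EuclideanSpace.proj 1 : Plane →L[ℝ] ℝ).hasFDerivAt
  have h3 := h1.unique (h2.congr_of_eventuallyEq (by
    filter_upwards [(isOpen_strip isOpen_Ioo).mem_nhds
      (show y ∈ strip (Set.Ioo (-δ) δ) from abs_lt.1 hy)] with z hz
    exact hδ.cutoff_collarMap i (abs_lt.2 hz)))
  have := congrArg (fun l : Plane →L[ℝ] ℝ => l w) h3
  simpa using this

lemma exists_cutoff_eq_one (hδ : S.IsCollarWidth δ) {x : Plane} (hx : x ∈ S.fluid) :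
    ∃ b, 0 < b ∧ b < δ ∧ S.cutoff δ b x = 1 := by
  by_cases h : ∃ y, S.IsCollarCoord δ x y
  · obtain ⟨y, hy⟩ := h
    have hpos := hδ.coord_pos_of_mem_fluid hx hy
    -- The profile of width `b` already equals one at `s = b`, so the point's own distance
    -- coordinate serves as width.
    refine ⟨y 1, hpos, lt_of_abs_lt hy.1, ?_⟩
    rw [hδ.cutoff_eq hy, profile_eq_one hpos le_rfl]
  · refine ⟨δ / 2, half_pos hδ.pos, half_lt_self hδ.pos, ?_⟩
    exact hδ.cutoff_of_mem_fluid (half_pos hδ.pos) hx fun y hy => absurd ⟨y, hy⟩ h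

end IsCollarWidth
end Suspension

/-! ### Integration of periodic functions over a cell. -/

open MeasureTheory
open scoped Pointwise

namespace Suspension

variable {N : ℕ} (S : Suspension N)

/-- The lattice as a subgroup of the plane. -/
abbrev lattice : AddSubgroup Plane := (Submodule.span ℤ (Set.range S.basis)).toAddSubgroup

/-- A unit cell. -/
def cell : Set Plane := ZSpan.fundamentalDomain S.basis

/-- `f` is doubly periodic. -/
def IsPeriodic {X : Type*} (f : Plane → X) : Prop := ∀ x m₁ m₂, f (x + S.shift m₁ m₂) = f x

variable {S}

lemma mem_lattice {x : Plane} : x ∈ S.lattice ↔ ∃ m₁ m₂, x = S.shift m₁ m₂ := by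
  rw [Submodule.mem_toAddSubgroup, Submodule.mem_span_range_iff_exists_fun]
  constructor
  · rintro ⟨c, rfl⟩
    exact ⟨c 0, c 1, by simp [Fin.sum_univ_two, shift, latticeVector, Int.cast_smul_eq_zsmul]⟩
  · rintro ⟨m₁, m₂, rfl⟩
    exact ⟨![m₁, m₂], by simp [Fin.sum_univ_two, shift, latticeVector, Int.cast_smul_eq_zsmul]⟩

lemma isAddFundamentalDomain_cell : IsAddFundamentalDomain S.lattice S.cell (volume : Measure Plane) :=
  ZSpan.isAddFundamentalDomain' S.basis volume

instance : Countable S.lattice := inferInstanceAs (Countable (Submodule.span ℤ (Set.range S.basis)))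

lemma measurableSet_cell : MeasurableSet S.cell := ZSpan.fundamentalDomain_measurableSet S.basis

lemma isBounded_cell : Bornology.IsBounded S.cell := ZSpan.fundamentalDomain_isBounded S.basis

lemma _root_.Continuous.integrableOn_of_isBounded {f : Plane → ℝ} (hf : Continuous f) {s : Set Plane}
    (hs : Bornology.IsBounded s) : IntegrableOn f s :=
  (hf.continuousOn.integrableOn_compact hs.isCompact_closure).mono_set subset_closure

lemma IsPeriodic.vadd {X : Type*} {f : Plane → X} (hf : S.IsPeriodic f) (g : S.lattice) (x : Plane) :
    f (g +ᵥ x) = f x := by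
  obtain ⟨m₁, m₂, hg⟩ := mem_lattice.1 g.2
  rw [AddSubgroup.vadd_def, hg, vadd_eq_add, add_comm]
  exact hf x m₁ m₂

/-- The integral of a periodic function over a cell is invariant under translation. -/
lemma integral_cell_add {f : Plane → ℝ} (hf : S.IsPeriodic f) (v : Plane) :
    ∫ x in S.cell, f (x + v) = ∫ x in S.cell, f x := by
  have h := (isAddFundamentalDomain_cell (S := S)).vadd_of_comm v
  rw [isAddFundamentalDomain_cell.setIntegral_eq h hf.vadd]
  have := (measurePreserving_vadd v (volume : Measure Plane)).setIntegral_image_emb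
    (measurableEmbedding_const_vadd v) f S.cell
  rw [← Set.image_vadd, this]
  simp [add_comm]

/-- The integral of `g(x + s v)` over the cell does not depend on `s`; differentiating under the
integral at `s = 0` gives the claim. No boundary of the cell enters. -/
lemma integral_cell_fderiv {g : Plane → ℝ} (hg : ContDiff ℝ 1 g) (hp : S.IsPeriodic g)
    (v : Plane) : ∫ x in S.cell, fderiv ℝ g x v = 0 := by
  have hcont : Continuous fun x => fderiv ℝ g x v :=
    (hg.continuous_fderiv (by simp)).clm_apply continuous_const
  obtain ⟨C, hC⟩ := ((isBounded_cell (S := S)).isCompact_closure.prod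
    (isCompact_closedBall (0 : ℝ) 1)).exists_bound_of_continuousOn
    (f := fun q : Plane × ℝ => fderiv ℝ g (q.1 + q.2 • v) v) (by
      exact (hcont.comp (by fun_prop : Continuous fun q : Plane × ℝ => q.1 + q.2 • v)).continuousOn)
  have hd := (hasDerivAt_integral_of_dominated_loc_of_deriv_le
    (μ := volume.restrict S.cell) (F := fun (s : ℝ) x => g (x + s • v))
    (F' := fun (s : ℝ) x => fderiv ℝ g (x + s • v) v) (x₀ := 0) (bound := fun _ => C)
    (s := Metric.ball 0 1) (Metric.ball_mem_nhds 0 one_pos)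
    (Filter.Eventually.of_forall fun s =>
      (hg.continuous.comp (by fun_prop)).aestronglyMeasurable)
    ((hg.continuous.comp (by fun_prop)).integrableOn_of_isBounded isBounded_cell)
    (hcont.comp (by fun_prop)).aestronglyMeasurable
    ?_ ?_ ?_).2
  · have hconst : (fun s : ℝ => ∫ x in S.cell, g (x + s • v)) = fun _ => ∫ x in S.cell, g x :=
      funext fun s => integral_cell_add hp (s • v)
    rw [hconst] at hd
    simpa using hd.unique (hasDerivAt_const (0 : ℝ) _)
  · filter_upwards [ae_restrict_mem measurableSet_cell] with x hx s hs
    exact hC (x, s) ⟨subset_closure hx, Metric.ball_subset_closedBall hs⟩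
  · have : IsFiniteMeasure (volume.restrict S.cell) :=
      ⟨by simpa using isBounded_cell.measure_lt_top⟩
    exact integrable_const C
  · filter_upwards with x s _
    have h1 : HasDerivAt (fun s : ℝ => x + s • v) v s := by
      simpa using ((hasDerivAt_id s).smul_const v).const_add x
    exact ((hg.differentiable (by simp) _).hasFDerivAt).comp_hasDerivAt s h1

/-- Unfolding: the integral over a cell of a periodic function that is supported in the disjoint
translates of the sets `C i` is the sum of the integrals over these sets. -/
lemma integral_cell_eq_sum {f : Plane → ℝ} (hf : Continuous f) (hp : S.IsPeriodic f)
    {C : Fin N → Set Plane} (hm : ∀ i, MeasurableSet (C i)) (hb : ∀ i, Bornology.IsBounded (C i))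
    (hd : ∀ x i j m₁ m₂ n₁ n₂, x + S.shift m₁ m₂ ∈ C i → x + S.shift n₁ n₂ ∈ C j →
      i = j ∧ m₁ = n₁ ∧ m₂ = n₂)
    (hs : ∀ x, f x ≠ 0 → ∃ i m₁ m₂, x + S.shift m₁ m₂ ∈ C i) :
    ∫ x in S.cell, f x = ∑ i, ∫ x in C i, f x := by
  have hmem : ∀ (i : Fin N) (g : S.lattice) (x : Plane), x ∈ g +ᵥ C i →
      ∃ m₁ m₂, (g : Plane) = -S.shift m₁ m₂ ∧ x + S.shift m₁ m₂ ∈ C i := fun i g x hx => by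
    obtain ⟨m₁, m₂, hg⟩ := mem_lattice.1 g.2
    refine ⟨-m₁, -m₂, by rw [shift_neg, neg_neg, hg], ?_⟩
    rw [Set.mem_vadd_set_iff_neg_vadd_mem, AddSubgroup.vadd_def] at hx
    rw [shift_neg, ← hg]
    convert hx using 1
    simp [add_comm]
  -- Each `C i` is cut by the translates of the cell and the pieces are moved back into the cell.
  -- The hypothesis `hd` keeps the moved pieces disjoint.
  have key : ∀ i, ∫ x in C i, f x = ∫ x in ⋃ g : S.lattice, (g +ᵥ C i) ∩ S.cell, f x := fun i => by
    rw [(isAddFundamentalDomain_cell (S := S)).setIntegral_eq_tsum' (hf.integrableOn_of_isBounded (hb i)),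
      integral_iUnion]
    · simp only [hp.vadd]
    · exact fun g => ((hm i).const_vadd g).inter measurableSet_cell
    · intro g g' hgg
      refine Set.disjoint_left.2 fun x hx hx' => hgg ?_
      obtain ⟨m₁, m₂, h1, h2⟩ := hmem i g x hx.1
      obtain ⟨n₁, n₂, h3, h4⟩ := hmem i g' x hx'.1
      obtain ⟨-, rfl, rfl⟩ := hd x i i _ _ _ _ h2 h4
      exact Subtype.ext (h1.trans h3.symm)
    · refine (hf.integrableOn_of_isBounded (isBounded_cell (S := S))).mono_set ?_
      exact Set.iUnion_subset fun g => Set.inter_subset_right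
  simp only [key]
  rw [← tsum_fintype (L := .unconditional _), ← integral_iUnion]
  · refine setIntegral_eq_of_subset_of_forall_sdiff_eq_zero measurableSet_cell ?_ ?_
    · exact Set.iUnion_subset fun i => Set.iUnion_subset fun g => Set.inter_subset_right
    · intro x hx
      by_contra h0
      obtain ⟨i, m₁, m₂, h⟩ := hs x h0
      refine hx.2 (Set.mem_iUnion.2 ⟨i, Set.mem_iUnion.2
        ⟨⟨-S.shift m₁ m₂, mem_lattice.2 ⟨-m₁, -m₂, (S.shift_neg m₁ m₂).symm⟩⟩, ?_, hx.1⟩⟩)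
      rw [Set.mem_vadd_set_iff_neg_vadd_mem, AddSubgroup.vadd_def]
      convert h using 1
      simp [add_comm]
  · exact fun i => MeasurableSet.iUnion fun g => ((hm i).const_vadd g).inter measurableSet_cell
  · intro i j hij
    refine Set.disjoint_left.2 fun x hx hx' => hij ?_
    obtain ⟨g, hg⟩ := Set.mem_iUnion.1 hx
    obtain ⟨g', hg'⟩ := Set.mem_iUnion.1 hx'
    obtain ⟨m₁, m₂, h1, h2⟩ := hmem i g x hg.1
    obtain ⟨n₁, n₂, h3, h4⟩ := hmem j g' x hg'.1
    exact (hd x i j _ _ _ _ h2 h4).1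
  · refine (hf.integrableOn_of_isBounded (isBounded_cell (S := S))).mono_set ?_
    exact Set.iUnion_subset fun i => Set.iUnion_subset fun g => Set.inter_subset_right

/-- The function vanishes almost everywhere on the cell, hence on the plane because its nonvanishing
set is lattice invariant. Continuity on the whole plane then removes the null set. -/
lemma eq_zero_of_integral_cell_eq_zero {f : Plane → ℝ} (hf : Continuous f) (hp : S.IsPeriodic f)
    (h0 : ∀ x, 0 ≤ f x) (hi : ∫ x in S.cell, f x = 0) (x : Plane) : f x = 0 := by
  rw [integral_eq_zero_iff_of_nonneg h0 (hf.integrableOn_of_isBounded (isBounded_cell (S := S)))] at hi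
  have hz : volume {x | f x ≠ 0} = 0 := by
    refine (isAddFundamentalDomain_cell (S := S)).measure_zero_of_invariant _ (fun g => ?_) ?_
    · ext x
      rw [Set.mem_vadd_set_iff_neg_vadd_mem]
      change f (-g +ᵥ x) ≠ 0 ↔ f x ≠ 0
      rw [hp.vadd]
    · have := (ae_iff.1 hi)
      rwa [Measure.restrict_apply' measurableSet_cell] at this
  have hae : f =ᵐ[volume] fun _ => 0 := ae_iff.2 hz
  exact congrFun ((hf.ae_eq_iff_eq volume continuous_const).1 hae) x

end Suspension

/-! ### Flux through a thin boundary layer. -/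

lemma measurePreserving_point : MeasurePreserving (fun q : ℝ × ℝ => point q.2 q.1) := by
  have h1 := (PiLp.volume_preserving_toLp (Fin 2)).comp
    ((volume_preserving_finTwoArrow ℝ).symm.comp
      (Measure.measurePreserving_swap (μ := (volume : Measure ℝ)) (ν := (volume : Measure ℝ))))
  exact h1

lemma measurableEmbedding_point : MeasurableEmbedding (fun q : ℝ × ℝ => point q.2 q.1) := by
  refine (continuous_point.comp continuous_swap).measurableEmbedding fun p q h => ?_
  have h0 := congrArg (fun w : Plane => w 0) h
  have h1 := congrArg (fun w : Plane => w 1) h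
  simp at h0 h1
  exact Prod.ext h1 h0

/-- The rectangle `I × J` in the plane. -/
def box (I J : Set ℝ) : Set Plane := {y | y 0 ∈ I ∧ y 1 ∈ J}

lemma measurableSet_box {I J : Set ℝ} (hI : MeasurableSet I) (hJ : MeasurableSet J) :
    MeasurableSet (box I J) :=
  (hI.preimage (continuous_coord 0).measurable).inter (hJ.preimage (continuous_coord 1).measurable)

/-- The coordinates are swapped so that Fubini puts the integral along the curve innermost. -/
lemma integral_box (I J : Set ℝ) (g : Plane → ℝ) :
    ∫ y in box I J, g y = ∫ q in J ×ˢ I, g (point q.2 q.1) := by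
  have h : (fun q : ℝ × ℝ => point q.2 q.1) ⁻¹' box I J = J ×ˢ I := by
    ext q; simp [box, and_comm]
  rw [← measurePreserving_point.setIntegral_preimage_emb measurableEmbedding_point, h]

namespace Suspension.IsCollarWidth

variable {N : ℕ} {S : Suspension N} {δ b : ℝ} {F : Plane → Plane}

/-- `F` is arbitrary inside the objects, but the differential of the cutoff is zero near every point
outside the open fluid. -/
lemma continuous_fderiv_cutoff_apply (hδ : S.IsCollarWidth δ) (hb : 0 < b) (hbδ : b < δ)
    (hF : ContinuousOn F S.closedFluid) :
    Continuous fun x => fderiv ℝ (S.cutoff δ b) x (F x) := by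
  rw [continuous_iff_continuousAt]
  intro x
  by_cases hx : x ∈ S.fluid
  · have h1 : ContinuousAt F x :=
      (hF.mono fluid_subset_closedFluid).continuousAt (isOpen_fluid.mem_nhds hx)
    exact ((hδ.contDiff_cutoff hb hbδ).continuous_fderiv (by simp)).continuousAt.clm_apply h1
  · have h0 : (fun x => fderiv ℝ (S.cutoff δ b) x (F x)) =ᶠ[nhds x] fun _ => 0 := by
      filter_upwards [(hδ.cutoff_eventually_zero hb hx).fderiv (𝕜 := ℝ)] with z hz
      rw [hz]
      simp
    exact continuousAt_const.congr_of_eventuallyEq h0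

lemma isPeriodic_fderiv_cutoff (hδ : S.IsCollarWidth δ) :
    S.IsPeriodic (fderiv ℝ (S.cutoff δ b)) := fun x m₁ m₂ => by
  rw [← fderiv_comp_add_right]
  congr 1
  exact funext fun x => hδ.cutoff_add_shift x m₁ m₂

lemma isPeriodic_fderiv_cutoff_apply (hδ : S.IsCollarWidth δ) (hb : 0 < b)
    (hp : ∀ x ∈ S.closedFluid, ∀ m₁ m₂, F (x + S.shift m₁ m₂) = F x) :
    S.IsPeriodic fun x => fderiv ℝ (S.cutoff δ b) x (F x) := fun x m₁ m₂ => by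
  simp only [hδ.isPeriodic_fderiv_cutoff x m₁ m₂]
  by_cases hx : x ∈ S.closedFluid
  · rw [hp x hx]
  · have : x ∉ S.fluid := fun h => hx (fluid_subset_closedFluid h)
    rw [(hδ.cutoff_eventually_zero hb this).fderiv_eq]
    simp

/-- A fundamental piece of the outer collar of width `b`. -/
abbrev collarBox (b : ℝ) : Set Plane := box (Set.Ioc 0 (2 * Real.pi)) (Set.Ioc 0 b)

lemma abs_lt_of_mem_collarBox (hbδ : b < δ) {y : Plane} (hy : y ∈ collarBox b) : |y 1| < δ := by
  rw [abs_of_pos hy.2.1]; exact hy.2.2.trans_lt hbδ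

lemma injOn_collarBox (hδ : S.IsCollarWidth δ) (hbδ : b < δ) (i : Fin N) :
    Set.InjOn (S.object i).collarMap (collarBox b) := by
  intro y hy z hz h
  obtain ⟨-, -, -, h1, k, h2⟩ := hδ.injective i i 0 0 y z (abs_lt_of_mem_collarBox hbδ hy)
    (abs_lt_of_mem_collarBox hbδ hz) (by simpa using h)
  have hpi := Real.two_pi_pos
  have hk : k = 0 := by
    have h3 : (k : ℝ) * (2 * Real.pi) < 1 * (2 * Real.pi) := by linarith [hz.1.2, hy.1.1]
    have h4 : (-1 : ℝ) * (2 * Real.pi) < k * (2 * Real.pi) := by linarith [hy.1.2, hz.1.1]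
    have h5 : (k : ℝ) < 1 := lt_of_mul_lt_mul_right h3 hpi.le
    have h6 : (-1 : ℝ) < k := lt_of_mul_lt_mul_right h4 hpi.le
    have h7 : k < 1 := by exact_mod_cast h5
    have h8 : -1 < k := by exact_mod_cast h6
    omega
  rw [← point_coords y, ← point_coords z, h1, h2, hk]
  simp

/-- The flux density in collar coordinates. -/
def fluxDensity (B : SmoothObject) (F : Plane → Plane) (y : Plane) : ℝ :=
  det2 (fderiv ℝ B.collarMap y (coord 0)) (F (B.collarMap y))

/-- The differential of the cutoff kills the tangential collar direction and takes the value of the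
profile's derivative on the transverse one, so Cramer's identity leaves one term. The minus sign is
that of the Jacobian. -/
lemma jacobian_mul_fderiv_cutoff (hδ : S.IsCollarWidth δ) (hb : 0 < b) (hbδ : b < δ) (i : Fin N)
    {y : Plane} (hy : |y 1| < δ) :
    |(fderiv ℝ (S.object i).collarMap y).det| *
        fderiv ℝ (S.cutoff δ b) ((S.object i).collarMap y) (F ((S.object i).collarMap y)) =
      -(deriv (profile b) (y 1) * fluxDensity (S.object i) F y) := by
  have hneg : (fderiv ℝ (S.object i).collarMap y).det < 0 := hδ.jacobian_neg i y hy
  have h := cramer_identity (fderiv ℝ (S.cutoff δ b) ((S.object i).collarMap y))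
    (fderiv ℝ (S.object i).collarMap y (coord 0)) (fderiv ℝ (S.object i).collarMap y (coord 1))
    (F ((S.object i).collarMap y))
  rw [hδ.fderiv_cutoff_collarMap hb hbδ i hy, hδ.fderiv_cutoff_collarMap hb hbδ i hy,
    ← det_eq_det2] at h
  simp [coord] at h
  rw [abs_of_neg hneg, fluxDensity]
  linarith

lemma continuousOn_fluxDensity (hδ : S.IsCollarWidth δ) (hF : ContinuousOn F S.closedFluid)
    (i : Fin N) : ContinuousOn (fluxDensity (S.object i) F) (strip (Set.Ico 0 δ)) := by
  have h1 : Continuous fun y => fderiv ℝ (S.object i).collarMap y (coord 0) :=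
    ((S.object i).contDiff_collarMap.continuous_fderiv (by simp)).clm_apply continuous_const
  have h2 : ContinuousOn (fun y => F ((S.object i).collarMap y)) (strip (Set.Ico 0 δ)) :=
    hF.comp (S.object i).continuous_collarMap.continuousOn fun y hy =>
      hδ.collarMap_mem_closedFluid i hy.1 hy.2
  exact continuous_det2.comp_continuousOn (h1.continuousOn.prodMk h2)

/-- The flux density is controlled only for `0 ≤ s < δ`. Clamping `s` to `[0, δ/2]` makes it
continuous everywhere without changing it on the collars that are used. -/
lemma continuous_fluxDensity_clamp (hδ : S.IsCollarWidth δ) (hF : ContinuousOn F S.closedFluid)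
    (i : Fin N) : Continuous fun q : ℝ × ℝ =>
      fluxDensity (S.object i) F (point q.2 (max 0 (min q.1 (δ / 2)))) := by
  refine (hδ.continuousOn_fluxDensity hF i).comp_continuous
    (continuous_point.comp (by fun_prop : Continuous fun q : ℝ × ℝ =>
      (q.2, max 0 (min q.1 (δ / 2))))) fun q => ?_
  have := half_lt_self hδ.pos
  simp only [strip]
  refine ⟨by simp, ?_⟩
  simp only [point_one]
  exact max_lt hδ.pos ((min_le_right _ _).trans_lt this)

lemma integral_collar (hδ : S.IsCollarWidth δ) (hb : 0 < b) (hbδ : b ≤ δ / 2)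
    (hF : ContinuousOn F S.closedFluid) (i : Fin N) :
    ∫ x in (S.object i).collarMap '' collarBox b, fderiv ℝ (S.cutoff δ b) x (F x) =
      -∫ s in Set.Ioc 0 b, deriv (profile b) s * ∫ t in (0 : ℝ)..(2 * Real.pi),
        fluxDensity (S.object i) F (point t (max 0 (min s (δ / 2)))) := by
  have hbδ' : b < δ := hbδ.trans_lt (half_lt_self hδ.pos)
  have hmeas : MeasurableSet (collarBox b) := measurableSet_box measurableSet_Ioc measurableSet_Ioc
  rw [integral_image_eq_integral_abs_det_fderiv_smul volume hmeas
    (fun y _ => ((S.object i).differentiable_collarMap y).hasFDerivAt.hasFDerivWithinAt)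
    (hδ.injOn_collarBox hbδ' i)]
  have h1 : ∫ y in collarBox b, |(fderiv ℝ (S.object i).collarMap y).det| •
      fderiv ℝ (S.cutoff δ b) ((S.object i).collarMap y) (F ((S.object i).collarMap y)) =
      ∫ y in collarBox b, -(deriv (profile b) (y 1) *
        fluxDensity (S.object i) F (point (y 0) (max 0 (min (y 1) (δ / 2))))) := by
    refine setIntegral_congr_fun hmeas fun y hy => ?_
    have hy1 := abs_lt_of_mem_collarBox hbδ' hy
    simp only [smul_eq_mul]
    rw [hδ.jacobian_mul_fderiv_cutoff hb hbδ' i hy1, min_eq_left (hy.2.2.trans hbδ),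
      max_eq_right hy.2.1.le, point_coords]
  have hcont : Continuous fun q : ℝ × ℝ => deriv (profile b) q.1 *
        fluxDensity (S.object i) F (point q.2 (max 0 (min q.1 (δ / 2)))) :=
    (((contDiff_profile b (n := 1)).continuous_deriv (by simp)).comp continuous_fst).mul
      (hδ.continuous_fluxDensity_clamp hF i)
  rw [h1, integral_neg, integral_box]
  simp only [point_zero, point_one]
  rw [Measure.volume_eq_prod, setIntegral_prod]
  · congr 1
    refine integral_congr_ae (Filter.Eventually.of_forall fun s => ?_)
    simp only
    rw [integral_const_mul, intervalIntegral.integral_of_le Real.two_pi_pos.le]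
  · rw [← Measure.volume_eq_prod]
    exact (hcont.continuousOn.integrableOn_compact (isCompact_Icc.prod isCompact_Icc)).mono_set
      (Set.prod_mono Set.Ioc_subset_Icc_self Set.Ioc_subset_Icc_self)

/-- The derivative of the profile is a nonnegative weight of total mass one on `(0, b]`, so the
layer integral is, up to sign, a mean of fluxes through parallel curves. -/
lemma abs_integral_collar_le (hδ : S.IsCollarWidth δ) (hb : 0 < b) (hbδ : b ≤ δ / 2)
    (hF : ContinuousOn F S.closedFluid) (i : Fin N) {κ : ℝ}
    (hκ : ∀ s ∈ Set.Ioc 0 b, |∫ t in (0 : ℝ)..(2 * Real.pi),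
        fluxDensity (S.object i) F (point t (max 0 (min s (δ / 2))))| ≤ κ) :
    |∫ x in (S.object i).collarMap '' collarBox b, fderiv ℝ (S.cutoff δ b) x (F x)| ≤ κ := by
  rw [hδ.integral_collar hb hbδ hF, abs_neg, ← Real.norm_eq_abs]
  have hc : Continuous (deriv (profile b)) :=
    (contDiff_profile b (n := 1)).continuous_deriv (by simp)
  refine (norm_integral_le_of_norm_le (g := fun s => deriv (profile b) s * κ) ?_ ?_).trans ?_
  · exact ((hc.mul continuous_const).continuousOn.integrableOn_compact isCompact_Icc).mono_set
      Set.Ioc_subset_Icc_self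
  · filter_upwards [ae_restrict_mem measurableSet_Ioc] with s hs
    rw [norm_mul, Real.norm_of_nonneg (deriv_profile_nonneg hb s), Real.norm_eq_abs]
    exact mul_le_mul_of_nonneg_left (hκ s hs) (deriv_profile_nonneg hb s)
  · rw [integral_mul_const, ← intervalIntegral.integral_of_le hb.le,
      intervalIntegral.integral_deriv_eq_sub
        (fun s _ => (contDiff_profile b (n := 1)).differentiable (by simp) s)
        (hc.intervalIntegrable _ _), profile_eq_one hb le_rfl, profile_eq_zero hb (by linarith)]
    simp

lemma integral_cell_fderiv_cutoff (hδ : S.IsCollarWidth δ) (hb : 0 < b) (hbδ : b < δ)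
    (hF : ContinuousOn F S.closedFluid)
    (hp : ∀ x ∈ S.closedFluid, ∀ m₁ m₂, F (x + S.shift m₁ m₂) = F x) :
    ∫ x in S.cell, fderiv ℝ (S.cutoff δ b) x (F x) =
      ∑ i, ∫ x in (S.object i).collarMap '' collarBox b, fderiv ℝ (S.cutoff δ b) x (F x) := by
  refine integral_cell_eq_sum (hδ.continuous_fderiv_cutoff_apply hb hbδ hF)
    (hδ.isPeriodic_fderiv_cutoff_apply hb hp) (fun i => ?_) (fun i => ?_) ?_ ?_
  · exact (measurableSet_box measurableSet_Ioc measurableSet_Ioc).image_of_continuousOn_injOn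
      (S.object i).continuous_collarMap.continuousOn (hδ.injOn_collarBox hbδ i)
  · refine (((isCompact_Icc (a := (0 : ℝ)) (b := 2 * Real.pi)).prod
      (isCompact_Icc (a := (0 : ℝ)) (b := b))).image
        ((S.object i).continuous_collarMap.comp continuous_point)).isBounded.subset ?_
    rintro _ ⟨y, hy, rfl⟩
    exact ⟨(y 0, y 1), ⟨Set.Ioc_subset_Icc_self hy.1, Set.Ioc_subset_Icc_self hy.2⟩, by
      simp [point_coords]⟩
  · rintro x i j m₁ m₂ n₁ n₂ ⟨y, hy, hxy⟩ ⟨z, hz, hxz⟩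
    obtain ⟨h1, h2, h3, -⟩ := hδ.injective i j (n₁ - m₁) (n₂ - m₂) y z
      (abs_lt_of_mem_collarBox hbδ hy) (abs_lt_of_mem_collarBox hbδ hz) (by
        rw [hxy, hxz, add_assoc, ← shift_add]
        congr 2 <;> ring)
    exact ⟨h1, by omega, by omega⟩
  · intro x hx
    by_contra hne
    refine hx ?_
    rw [hδ.fderiv_cutoff_eq_zero hb hbδ]
    · simp
    rintro y ⟨-, i, m₁, m₂, hxy⟩ hpos
    by_contra! hyb
    refine hne ⟨i, m₁, m₂, point (toIocMod Real.two_pi_pos 0 (y 0)) (y 1),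
      ⟨by simpa using toIocMod_mem_Ioc Real.two_pi_pos 0 (y 0), by simpa using ⟨hpos, hyb⟩⟩, ?_⟩
    rw [hxy, ← (S.object i).collarMap_add_period _ (toIocDiv Real.two_pi_pos 0 (y 0))]
    congr 1
    have h1 := toIocMod_add_toIocDiv_zsmul Real.two_pi_pos 0 (y 0)
    rw [zsmul_eq_mul] at h1
    ext l; fin_cases l <;> simp [h1]

/-- If the flux of `F` through the boundary of each object vanishes, then the flux of `F` through
the boundary layer of width `b` is small. -/
theorem exists_flux_le (hδ : S.IsCollarWidth δ) (hF : ContinuousOn F S.closedFluid)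
    (hp : ∀ x ∈ S.closedFluid, ∀ m₁ m₂, F (x + S.shift m₁ m₂) = F x)
    (hflux : ∀ i, ∫ t in (0 : ℝ)..(2 * Real.pi),
      det2 (deriv (S.object i).curve t) (F ((S.object i).curve t)) = 0)
    {κ : ℝ} (hκ : 0 < κ) :
    ∃ b₀ > 0, ∀ b, 0 < b → b ≤ b₀ → b < δ ∧
      |∫ x in S.cell, fderiv ℝ (S.cutoff δ b) x (F x)| ≤ N * κ := by
  have hev : ∀ i, ∀ᶠ s in nhds (0 : ℝ), |∫ t in (0 : ℝ)..(2 * Real.pi),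
      fluxDensity (S.object i) F (point t (max 0 (min s (δ / 2))))| < κ := fun i => by
    have hc : Continuous fun s : ℝ => |∫ t in (0 : ℝ)..(2 * Real.pi),
        fluxDensity (S.object i) F (point t (max 0 (min s (δ / 2))))| :=
      (intervalIntegral.continuous_parametric_intervalIntegral_of_continuous'
        (f := fun s t => fluxDensity (S.object i) F (point t (max 0 (min s (δ / 2)))))
        (hδ.continuous_fluxDensity_clamp hF i) 0 (2 * Real.pi)).abs
    refine hc.continuousAt.eventually (gt_mem_nhds ?_)
    -- At `s = 0` the parallel curve is the boundary itself, whose flux vanishes by hypothesis;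
    -- continuity in `s` does the rest.
    have h0 : max 0 (min 0 (δ / 2)) = 0 := by
      rw [min_eq_left (half_pos hδ.pos).le, max_self]
    simp only [h0, fluxDensity, SmoothObject.collarMap_point_zero,
      SmoothObject.fderiv_collarMap_zero, point_zero, point_one, zero_smul, sub_zero, hflux]
    simpa using hκ
  obtain ⟨r, hr, h⟩ := Metric.eventually_nhds_iff.1 (Filter.eventually_all.2 hev)
  refine ⟨min (r / 2) (δ / 2), lt_min (half_pos hr) (half_pos hδ.pos), fun b hb hb0 => ?_⟩
  have hb1 : b ≤ δ / 2 := hb0.trans (min_le_right _ _)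
  have hb2 : b ≤ r / 2 := hb0.trans (min_le_left _ _)
  have hbδ : b < δ := hb1.trans_lt (half_lt_self hδ.pos)
  refine ⟨hbδ, ?_⟩
  rw [hδ.integral_cell_fderiv_cutoff hb hbδ hF hp]
  refine (Finset.abs_sum_le_sum_abs _ _).trans ?_
  refine (Finset.sum_le_sum fun i _ => hδ.abs_integral_collar_le hb hb1 hF i (κ := κ)
    fun s hs => (h (y := s) ?_ i).le).trans ?_
  · rw [Real.dist_eq, sub_zero, abs_of_pos hs.1]
    linarith [hs.2]
  · simp

end Suspension.IsCollarWidth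

/-! ### Pointwise identities for the Stokes flow. -/

namespace Suspension

variable {N : ℕ} {S : Suspension N}

/-- A function with vanishing derivative in the fluid domain is locally constant there. -/
lemma eventually_eq_of_fderiv_eq_zero {E : Type*} [NormedAddCommGroup E] [NormedSpace ℝ E]
    {f : Plane → E} (hf : DifferentiableOn ℝ f S.fluid) (h0 : ∀ x ∈ S.fluid, fderiv ℝ f x = 0)
    {x : Plane} (hx : x ∈ S.fluid) : ∀ᶠ y in nhds x, f y = f x := by
  obtain ⟨r, hr, hsub⟩ := Metric.isOpen_iff.1 isOpen_fluid x hx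
  filter_upwards [Metric.ball_mem_nhds x hr] with y hy
  exact Metric.isOpen_ball.is_const_of_fderiv_eq_zero (convex_ball x r).isPreconnected
    (hf.mono hsub) (fun z hz => h0 z (hsub hz)) hy (Metric.mem_ball_self hr)

end Suspension

namespace IsMobilitySolution

open Suspension

variable {N : ℕ} {S : Suspension N} {μ : ℝ} {u : Plane → Plane} {p : Plane → ℝ}
  {v : Fin N → Plane} {ω : Fin N → ℝ}

lemma closedFluid_mem_nhds {x : Plane} (hx : x ∈ S.fluid) : S.closedFluid ∈ nhds x :=
  Filter.mem_of_superset (isOpen_fluid.mem_nhds hx) fluid_subset_closedFluid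

lemma fderivWithin_eventuallyEq {x : Plane} (hx : x ∈ S.fluid) :
    fderivWithin ℝ u S.closedFluid =ᶠ[nhds x] fderiv ℝ u := by
  filter_upwards [isOpen_fluid.mem_nhds hx] with y hy
  exact fderivWithin_of_mem_nhds (closedFluid_mem_nhds hy)

lemma contDiffAt_velocity (h : IsMobilitySolution S μ (fun _ => 0) u p v ω) {x : Plane}
    (hx : x ∈ S.fluid) : ContDiffAt ℝ 2 u x :=
  h.contDiffOn_velocity.contDiffAt (isOpen_fluid.mem_nhds hx)

lemma contDiffAt_fderivWithin (h : IsMobilitySolution S μ (fun _ => 0) u p v ω) {x : Plane}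
    (hx : x ∈ S.fluid) : ContDiffAt ℝ 1 (fderivWithin ℝ u S.closedFluid) x :=
  ((h.contDiffAt_velocity hx).fderiv_right (m := 1) (by norm_num)).congr_of_eventuallyEq
    (fderivWithin_eventuallyEq hx)

/-- The second partial derivative `∂ₖ ∂ⱼ uᵢ`. -/
def second (u : Plane → Plane) (x : Plane) (i j k : Fin 2) : ℝ :=
  (fderiv ℝ (fderiv ℝ u) x (coord k) (coord j)) i

lemma second_symm (h : IsMobilitySolution S μ (fun _ => 0) u p v ω) {x : Plane}
    (hx : x ∈ S.fluid) (i j k : Fin 2) : second u x i j k = second u x i k j := by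
  have := (h.contDiffAt_velocity hx).isSymmSndFDerivAt (by simp)
  rw [second, second, this.eq]

lemma hasFDerivAt_partialWithin (h : IsMobilitySolution S μ (fun _ => 0) u p v ω) {x : Plane}
    (hx : x ∈ S.fluid) (i j : Fin 2) :
    ∃ l : Plane →L[ℝ] ℝ, (∀ k, l (coord k) = second u x i j k) ∧
      HasFDerivAt (fun y => partialWithin S.closedFluid u y i j) l x := by
  have h1 : HasFDerivAt (fderivWithin ℝ u S.closedFluid) (fderiv ℝ (fderiv ℝ u) x) x := by
    rw [← (fderivWithin_eventuallyEq hx).fderiv_eq]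
    exact ((h.contDiffAt_fderivWithin hx).differentiableAt (by simp)).hasFDerivAt
  have h2 := ((EuclideanSpace.proj i : Plane →L[ℝ] ℝ).hasFDerivAt.comp x
    (h1.clm_apply (hasFDerivAt_const (coord j) x)))
  refine ⟨_, fun k => ?_, h2⟩
  simp [second]

lemma sum_second_eq_zero (h : IsMobilitySolution S μ (fun _ => 0) u p v ω) {x : Plane}
    (hx : x ∈ S.fluid) (k : Fin 2) : ∑ i, second u x i i k = 0 := by
  choose l hl hd using fun i => h.hasFDerivAt_partialWithin hx i i
  have h1 := HasFDerivAt.fun_sum (u := Finset.univ) fun i _ => hd i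
  have h2 : (fun y => ∑ i, partialWithin S.closedFluid u y i i) =ᶠ[nhds x] fun _ => (0 : ℝ) := by
    filter_upwards [isOpen_fluid.mem_nhds hx] with y hy
    rw [← h.incompressible y hy]
    simp [partialWithin, fderivWithin_of_mem_nhds (closedFluid_mem_nhds hy)]
  have h3 := h1.unique ((hasFDerivAt_const (0 : ℝ) x).congr_of_eventuallyEq h2)
  have h4 := congrArg (fun l : Plane →L[ℝ] ℝ => l (coord k)) h3
  simpa [hl] using h4

lemma sum_partialWithin_eq_zero (h : IsMobilitySolution S μ (fun _ => 0) u p v ω) {x : Plane}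
    (hx : x ∈ S.fluid) : ∑ i, partialWithin S.closedFluid u x i i = 0 := by
  rw [← h.incompressible x hx]
  simp [partialWithin, fderivWithin_of_mem_nhds (closedFluid_mem_nhds hx)]

lemma stokes_coord (h : IsMobilitySolution S μ (fun _ => 0) u p v ω) {x : Plane}
    (hx : x ∈ S.fluid) (i : Fin 2) :
    fderiv ℝ p x (coord i) = μ * ∑ j, second u x i j j := by
  have h1 := congrArg (fun w : Plane => w i) (h.stokes x hx)
  have h2 : gradient p x i = fderiv ℝ p x (coord i) := by
    have : inner ℝ (gradient p x) (coord i) = fderiv ℝ p x (coord i) := by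
      rw [gradient, InnerProductSpace.toDual_symm_apply]
    rw [← this, EuclideanSpace.inner_single_right]
    simp
  have h3 : Laplacian.laplacian u x i = ∑ j, second u x i j j := by
    rw [congrFun (InnerProductSpace.laplacian_eq_iteratedFDeriv_orthonormalBasis u
      (EuclideanSpace.basisFun (Fin 2) ℝ)) x]
    simp [iteratedFDeriv_two_apply, second, coord]
  simp only [PiLp.add_apply, PiLp.neg_apply, PiLp.smul_apply, PiLp.zero_apply, smul_eq_mul, h2, h3]
    at h1
  linarith

/-- The power density `σ u` of the flow. -/
def power (S : Suspension N) (μ : ℝ) (u : Plane → Plane) (p : Plane → ℝ) (x : Plane) : Plane :=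
  traction μ S.closedFluid u p x (u x)

lemma power_apply (x : Plane) (j : Fin 2) : power S μ u p x j =
    ∑ i, (-(if j = i then p x else 0) + μ * (partialWithin S.closedFluid u x j i +
      partialWithin S.closedFluid u x i j)) * u x i := by
  fin_cases j <;> simp [power, traction, stress]

/-- The dissipation density. -/
def dissipation (S : Suspension N) (μ : ℝ) (u : Plane → Plane) (x : Plane) : ℝ :=
  μ / 2 * ∑ i, ∑ j, (partialWithin S.closedFluid u x i j + partialWithin S.closedFluid u x j i) ^ 2

lemma contDiffAt_power (h : IsMobilitySolution S μ (fun _ => 0) u p v ω) {x : Plane}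
    (hx : x ∈ S.fluid) (j : Fin 2) : ContDiffAt ℝ 1 (fun y => power S μ u p y j) x := by
  have hu : ∀ i, ContDiffAt ℝ 1 (fun y => u y i) x := fun i =>
    (SmoothObject.contDiff_coord i).contDiffAt.comp x ((h.contDiffAt_velocity hx).of_le (by norm_num))
  have hp : ContDiffAt ℝ 1 p x := h.contDiffOn_pressure.contDiffAt (isOpen_fluid.mem_nhds hx)
  have ha : ∀ i j, ContDiffAt ℝ 1 (fun y => partialWithin S.closedFluid u y i j) x := fun i j =>
    (SmoothObject.contDiff_coord i).contDiffAt.comp x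
      ((h.contDiffAt_fderivWithin hx).clm_apply contDiffAt_const)
  simp only [power_apply]
  refine ContDiffAt.sum fun i _ => ContDiffAt.mul (ContDiffAt.add (ContDiffAt.neg ?_)
    (contDiffAt_const.mul ((ha j i).add (ha i j)))) (hu i)
  split_ifs
  · exact hp
  · exact contDiffAt_const

/-- The divergence of the power density is the dissipation density. -/
lemma divergence_power (h : IsMobilitySolution S μ (fun _ => 0) u p v ω) {x : Plane}
    (hx : x ∈ S.fluid) :
    ∑ j, fderiv ℝ (fun y => power S μ u p y j) x (coord j) = dissipation S μ u x := by
  have hp : HasFDerivAt p (fderiv ℝ p x) x :=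
    ((h.contDiffOn_pressure.contDiffAt (isOpen_fluid.mem_nhds hx)).differentiableAt
      (by simp)).hasFDerivAt
  have hu : ∀ i, HasFDerivAt (fun y => u y i)
      ((EuclideanSpace.proj i : Plane →L[ℝ] ℝ).comp (fderiv ℝ u x)) x := fun i =>
    (EuclideanSpace.proj i : Plane →L[ℝ] ℝ).hasFDerivAt.comp x
      ((h.contDiffAt_velocity hx).differentiableAt (by simp)).hasFDerivAt
  choose l hl hd using h.hasFDerivAt_partialWithin hx
  have hu' : ∀ i j, (EuclideanSpace.proj i : Plane →L[ℝ] ℝ).comp (fderiv ℝ u x) (coord j) =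
      partialWithin S.closedFluid u x i j := fun i j => by
    simp [partialWithin, fderivWithin_of_mem_nhds (closedFluid_mem_nhds hx)]
  have hq : ∀ i j : Fin 2, HasFDerivAt (fun y => -(if j = i then p y else 0))
      (-(if j = i then fderiv ℝ p x else 0)) x := fun i j => by
    split_ifs
    · exact hp.neg
    · exact (hasFDerivAt_const (0 : ℝ) x).neg
  have hF : ∀ j k, fderiv ℝ (fun y => power S μ u p y j) x (coord k) =
      ∑ i, ((-(if j = i then p x else 0) + μ * (partialWithin S.closedFluid u x j i +
        partialWithin S.closedFluid u x i j)) * partialWithin S.closedFluid u x i k +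
        u x i * (-(if j = i then fderiv ℝ p x (coord k) else 0) +
          μ * (second u x j i k + second u x i j k))) := fun j k => by
    simp only [power_apply]
    rw [(HasFDerivAt.fun_sum (u := Finset.univ) fun i _ =>
      ((hq i j).fun_add (((hd j i).fun_add (hd i j)).const_mul μ)).fun_mul (hu i)).fderiv]
    simp only [sum_apply, add_apply, smul_apply, neg_apply, smul_eq_mul, hl, hu']
    refine Finset.sum_congr rfl fun i _ => ?_
    split_ifs <;> simp
  have s1 := h.stokes_coord hx 0
  have s2 := h.stokes_coord hx 1
  have d0 := h.sum_partialWithin_eq_zero hx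
  have d1 := h.sum_second_eq_zero hx 0
  have d2 := h.sum_second_eq_zero hx 1
  have y1 := h.second_symm hx 0 0 1
  have y2 := h.second_symm hx 1 0 1
  simp only [hF, dissipation, Fin.sum_univ_two, if_true, Fin.isValue, zero_ne_one, one_ne_zero,
    if_false] at s1 s2 d0 d1 d2 y1 y2 ⊢
  rw [s1, s2]
  -- The divergence of `σu` is `(div σ)·u + σ : ∇u`. The term `-p div u` drops by `d0`. With the
  -- Stokes equation inserted, `div σ` reduces to `μ ∇(div u)`, which the differentiated
  -- incompressibility and the symmetry of second derivatives remove.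
  linear_combination (-p x) * d0 + u x 0 * μ * (d1 + y2) + u x 1 * μ * (d2 - y1)

lemma continuousOn_fderivWithin (h : IsMobilitySolution S μ (fun _ => 0) u p v ω) :
    ContinuousOn (fderivWithin ℝ u S.closedFluid) S.closedFluid :=
  h.contDiffOn_velocity_closed.continuousOn_fderivWithin uniqueDiffOn_closedFluid (by simp)

lemma continuousOn_partialWithin (h : IsMobilitySolution S μ (fun _ => 0) u p v ω) (i j : Fin 2) :
    ContinuousOn (fun x => partialWithin S.closedFluid u x i j) S.closedFluid :=
  (continuous_coord i).comp_continuousOn (h.continuousOn_fderivWithin.clm_apply continuousOn_const)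

lemma continuousOn_traction (h : IsMobilitySolution S μ (fun _ => 0) u p v ω) {X : Type*}
    [TopologicalSpace X] {s : Set X} {f n : X → Plane} (hf : ContinuousOn f s)
    (hn : ContinuousOn n s) (hs : ∀ y ∈ s, f y ∈ S.closedFluid) :
    ContinuousOn (fun y => traction μ S.closedFluid u p (f y) (n y)) s := by
  have hp : ContinuousOn (fun y => p (f y)) s := h.continuousOn_pressure_closed.comp hf hs
  have ha : ∀ i j, ContinuousOn (fun y => partialWithin S.closedFluid u (f y) i j) s := fun i j =>
    (h.continuousOn_partialWithin i j).comp hf hs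
  have hn' : ∀ i, ContinuousOn (fun y => n y i) s := fun i =>
    (continuous_coord i).comp_continuousOn hn
  refine (PiLp.continuous_toLp 2 _).comp_continuousOn (continuousOn_pi.2 fun i => ?_)
  simp only [stress, Matrix.mulVec, dotProduct, Matrix.of_apply]
  refine continuousOn_finsetSum _ fun j _ => ContinuousOn.mul (ContinuousOn.add
    (ContinuousOn.neg ?_) (continuousOn_const.mul ((ha i j).add (ha j i)))) (hn' j)
  split_ifs
  · exact hp
  · exact continuousOn_const

lemma continuousOn_power (h : IsMobilitySolution S μ (fun _ => 0) u p v ω) :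
    ContinuousOn (power S μ u p) S.closedFluid :=
  h.continuousOn_traction continuousOn_id h.contDiffOn_velocity_closed.continuousOn fun _ hy => hy

lemma fderivWithin_add_shift (h : IsMobilitySolution S μ (fun _ => 0) u p v ω) {x : Plane}
    (hx : x ∈ S.closedFluid) (m₁ m₂ : ℤ) :
    fderivWithin ℝ u S.closedFluid (x + S.shift m₁ m₂) = fderivWithin ℝ u S.closedFluid x := by
  have hs : S.shift m₁ m₂ +ᵥ S.closedFluid = S.closedFluid := by
    ext y
    rw [Set.mem_vadd_set_iff_neg_vadd_mem, vadd_eq_add, ← shift_neg, add_comm,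
      add_shift_mem_closedFluid]
  have h1 := fderivWithin_comp_add_right (𝕜 := ℝ) (f := u) (s := S.closedFluid) (x := x)
    (S.shift m₁ m₂)
  rw [hs] at h1
  rw [← h1]
  exact fderivWithin_congr (fun y hy => h.periodic_velocity y hy m₁ m₂)
    (h.periodic_velocity x hx m₁ m₂)

lemma power_add_shift (h : IsMobilitySolution S μ (fun _ => 0) u p v ω) (x : Plane)
    (hx : x ∈ S.closedFluid) (m₁ m₂ : ℤ) :
    power S μ u p (x + S.shift m₁ m₂) = power S μ u p x := by
  ext j
  simp only [power_apply, partialWithin, h.fderivWithin_add_shift hx]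
  have h1 : u (x + S.shift m₁ m₂) = u x := h.periodic_velocity x hx m₁ m₂
  have h2 : p (x + S.shift m₁ m₂) = p x := h.periodic_pressure x hx m₁ m₂
  rw [h1, h2]

lemma dissipation_add_shift (h : IsMobilitySolution S μ (fun _ => 0) u p v ω) {x : Plane}
    (hx : x ∈ S.closedFluid) (m₁ m₂ : ℤ) :
    dissipation S μ u (x + S.shift m₁ m₂) = dissipation S μ u x := by
  simp only [dissipation, partialWithin, h.fderivWithin_add_shift hx]

lemma dissipation_nonneg (hμ : 0 < μ) (x : Plane) : 0 ≤ dissipation S μ u x := by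
  unfold dissipation; positivity

/-- The stress tensor is symmetric. -/
lemma inner_traction (x a b : Plane) : inner ℝ (traction μ S.closedFluid u p x a) b =
    inner ℝ a (traction μ S.closedFluid u p x b) := by
  simp [inner_eq_sum, traction, stress]
  ring

/-- The objects exert no power on the fluid. -/
lemma flux_power (h : IsMobilitySolution S μ (fun _ => 0) u p v ω) (i : Fin N) :
    ∫ t in (0 : ℝ)..(2 * Real.pi), det2 (deriv (S.object i).curve t)
      (power S μ u p ((S.object i).curve t)) = 0 := by
  set B := S.object i with hB
  have hne : ∀ t, ‖deriv B.curve t‖ ≠ 0 := fun t => norm_ne_zero_iff.2 (B.deriv_curve_ne_zero t)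
  have hγ' : Continuous (deriv B.curve) := B.contDiff_deriv_curve.continuous
  have hγ : Continuous B.curve := B.contDiff_curve.continuous
  have hnormal : Continuous B.outwardNormal :=
    ((hγ'.norm.inv₀ hne).smul (perpL.continuous.comp hγ')).neg
  have hT : Continuous (S.boundaryTraction μ u p i) :=
    continuousOn_univ.1 (h.continuousOn_traction hγ.continuousOn hnormal.continuousOn
      fun t _ => curve_mem_closedFluid i t)
  have key : ∀ t, det2 (deriv B.curve t) (power S μ u p (B.curve t)) =
      -(inner ℝ (‖deriv B.curve t‖ • S.boundaryTraction μ u p i t) (v i) +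
        ω i * (‖deriv B.curve t‖ • inner ℝ (S.boundaryTraction μ u p i t)
          (perp (B.curve t - B.centroid)))) := fun t => by
    have hu : u (B.curve t) = v i + ω i • perp (B.curve t - B.centroid) := by
      simpa using h.rigid i (B.curve t) (B.curve_mem_frontier t)
    -- The determinant with the tangent is minus the speed times the normal component. Symmetry of
    -- `σ` then turns `(n, σu)` into `(T, u)`.
    have h1 : det2 (deriv B.curve t) (power S μ u p (B.curve t)) =
        -(‖deriv B.curve t‖ * inner ℝ (B.outwardNormal t) (power S μ u p (B.curve t))) := by
      have : ‖deriv B.curve t‖ • B.outwardNormal t = -perp (deriv B.curve t) := by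
        rw [SmoothObject.outwardNormal, smul_neg, smul_smul, mul_inv_cancel₀ (hne t), one_smul]
      rw [← real_inner_smul_left, this, inner_eq_sum]
      simp [det2]
      ring
    have h2 : inner ℝ (B.outwardNormal t) (power S μ u p (B.curve t)) =
        inner ℝ (S.boundaryTraction μ u p i t) (u (B.curve t)) :=
      (inner_traction _ _ _).symm
    rw [h1, h2, hu, inner_add_right, real_inner_smul_right, real_inner_smul_left, smul_eq_mul]
    ring
  simp only [key]
  have hperp : Continuous fun t => perp (B.curve t - B.centroid) :=
    perpL.continuous.comp (hγ.sub continuous_const)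
  have c1 : Continuous fun t => ‖deriv B.curve t‖ • S.boundaryTraction μ u p i t :=
    hγ'.norm.smul hT
  have c2 : Continuous fun t => ‖deriv B.curve t‖ • inner ℝ (S.boundaryTraction μ u p i t)
      (perp (B.curve t - B.centroid)) := hγ'.norm.smul (hT.inner hperp)
  have i1 : ∫ t in (0 : ℝ)..(2 * Real.pi),
      inner ℝ (‖deriv B.curve t‖ • S.boundaryTraction μ u p i t) (v i) = 0 := by
    have := (innerSL ℝ (v i)).intervalIntegral_comp_comm
      (c1.intervalIntegrable (μ := volume) 0 (2 * Real.pi))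
    have hf : ∫ t in (0 : ℝ)..(2 * Real.pi), ‖deriv B.curve t‖ • S.boundaryTraction μ u p i t = 0 :=
      h.force_free i
    rw [hf, map_zero] at this
    simpa only [innerSL_apply_apply, real_inner_comm] using this
  have i2 : ∫ t in (0 : ℝ)..(2 * Real.pi), ‖deriv B.curve t‖ •
      inner ℝ (S.boundaryTraction μ u p i t) (perp (B.curve t - B.centroid)) = 0 :=
    h.torque_free i
  rw [intervalIntegral.integral_neg, intervalIntegral.integral_add
    ((c1.inner continuous_const).intervalIntegrable _ _)
    ((c2.intervalIntegrable _ _).const_mul (ω i)), intervalIntegral.integral_const_mul, i1, i2]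
  simp

/-! ### The energy identity and the vanishing of the dissipation. -/

section Energy

variable {δ b : ℝ}

lemma continuous_cutoff_mul_dissipation (h : IsMobilitySolution S μ (fun _ => 0) u p v ω)
    (hδ : S.IsCollarWidth δ) (hb : 0 < b) (hbδ : b < δ) :
    Continuous fun x => S.cutoff δ b x * dissipation S μ u x := by
  have hd : ContinuousOn (dissipation S μ u) S.closedFluid :=
    continuousOn_const.mul (continuousOn_finsetSum _ fun i _ => continuousOn_finsetSum _ fun j _ =>
      ((h.continuousOn_partialWithin i j).add (h.continuousOn_partialWithin j i)).pow 2)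
  rw [continuous_iff_continuousAt]
  intro x
  by_cases hx : x ∈ S.fluid
  · exact (hδ.contDiff_cutoff hb hbδ).continuous.continuousAt.mul
      (hd.continuousAt (closedFluid_mem_nhds hx))
  · have h0 : (fun x => S.cutoff δ b x * dissipation S μ u x) =ᶠ[nhds x] fun _ => 0 := by
      filter_upwards [hδ.cutoff_eventually_zero hb hx] with z hz
      rw [hz, zero_mul]
    exact continuousAt_const.congr_of_eventuallyEq h0

lemma isPeriodic_cutoff_mul_dissipation (h : IsMobilitySolution S μ (fun _ => 0) u p v ω)
    (hδ : S.IsCollarWidth δ) (hb : 0 < b) :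
    S.IsPeriodic fun x => S.cutoff δ b x * dissipation S μ u x := fun x m₁ m₂ => by
  simp only [hδ.cutoff_add_shift]
  by_cases hx : x ∈ S.solid
  · rw [hδ.cutoff_of_mem_solid hb hx, zero_mul, zero_mul]
  · rw [h.dissipation_add_shift hx]

/-- The energy identity for the localized flow. -/
lemma integral_cutoff_mul_dissipation (h : IsMobilitySolution S μ (fun _ => 0) u p v ω)
    (hδ : S.IsCollarWidth δ) (hb : 0 < b) (hbδ : b < δ) :
    ∫ x in S.cell, S.cutoff δ b x * dissipation S μ u x =
      -∫ x in S.cell, fderiv ℝ (S.cutoff δ b) x (power S μ u p x) := by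
  have hχ := hδ.contDiff_cutoff hb hbδ
  have hzero : ∀ j, ∀ x ∉ S.fluid,
      (fun x => S.cutoff δ b x * power S μ u p x j) =ᶠ[nhds x] fun _ => 0 := fun j x hx => by
    filter_upwards [hδ.cutoff_eventually_zero hb hx] with z hz
    rw [hz, zero_mul]
  -- The power density is `C¹` only in the open fluid; multiplied by the cutoff it extends by zero
  -- to a `C¹` periodic function on the plane.
  have hG : ∀ j, ContDiff ℝ 1 fun x => S.cutoff δ b x * power S μ u p x j := fun j => by
    rw [contDiff_iff_contDiffAt]
    intro x
    by_cases hx : x ∈ S.fluid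
    · exact hχ.contDiffAt.mul (h.contDiffAt_power hx j)
    · exact contDiffAt_const.congr_of_eventuallyEq (hzero j x hx)
  have hp : ∀ j, S.IsPeriodic fun x => S.cutoff δ b x * power S μ u p x j := fun j x m₁ m₂ => by
    simp only [hδ.cutoff_add_shift]
    by_cases hx : x ∈ S.solid
    · rw [hδ.cutoff_of_mem_solid hb hx, zero_mul, zero_mul]
    · rw [h.power_add_shift x hx]
  have hdiv : ∀ x, ∑ j, fderiv ℝ (fun x => S.cutoff δ b x * power S μ u p x j) x (coord j) =
      S.cutoff δ b x * dissipation S μ u x + fderiv ℝ (S.cutoff δ b) x (power S μ u p x) := by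
    intro x
    by_cases hx : x ∈ S.fluid
    · have h1 : ∀ j, fderiv ℝ (fun x => S.cutoff δ b x * power S μ u p x j) x (coord j) =
          S.cutoff δ b x * fderiv ℝ (fun y => power S μ u p y j) x (coord j) +
            power S μ u p x j * fderiv ℝ (S.cutoff δ b) x (coord j) := fun j => by
        rw [fderiv_fun_mul (hχ.differentiable (by simp) x)
          ((h.contDiffAt_power hx j).differentiableAt (by simp))]
        simp
      simp only [h1]
      rw [Finset.sum_add_distrib, ← Finset.mul_sum, h.divergence_power hx]
      congr 1
      conv_rhs => rw [plane_eq_sum (power S μ u p x)]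
      simp [Fin.sum_univ_two]
    · have h1 : ∀ j, fderiv ℝ (fun x => S.cutoff δ b x * power S μ u p x j) x = 0 := fun j => by
        rw [(hzero j x hx).fderiv_eq]; simp
      have h2 := hδ.cutoff_eventually_zero hb hx
      rw [h2.fderiv_eq, h2.eq_of_nhds]
      simp [h1]
  have hsum : ∫ x in S.cell, ∑ j, fderiv ℝ (fun x => S.cutoff δ b x * power S μ u p x j) x
      (coord j) = 0 := by
    rw [integral_finsetSum]
    · exact Finset.sum_eq_zero fun j _ => integral_cell_fderiv (hG j) (hp j) _
    · exact fun j _ => (((hG j).continuous_fderiv (by simp)).clm_apply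
        continuous_const).integrableOn_of_isBounded isBounded_cell
  simp only [hdiv] at hsum
  rw [integral_add
    ((h.continuous_cutoff_mul_dissipation hδ hb hbδ).integrableOn_of_isBounded isBounded_cell)
    ((hδ.continuous_fderiv_cutoff_apply hb hbδ h.continuousOn_power).integrableOn_of_isBounded
      isBounded_cell)] at hsum
  linarith

/-- There is no dissipation. -/
lemma dissipation_eq_zero (h : IsMobilitySolution S μ (fun _ => 0) u p v ω) (hμ : 0 < μ)
    {x : Plane} (hx : x ∈ S.fluid) : dissipation S μ u x = 0 := by
  obtain ⟨δ, hδ⟩ := S.exists_isCollarWidth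
  obtain ⟨c, hc, hcδ, hcx⟩ := hδ.exists_cutoff_eq_one hx
  have hnn : ∀ b y, 0 ≤ S.cutoff δ b y * dissipation S μ u y := fun b y =>
    mul_nonneg (IsCollarWidth.cutoff_nonneg b y) (dissipation_nonneg hμ y)
  have hint : ∀ b, 0 < b → b < δ →
      IntegrableOn (fun x => S.cutoff δ b x * dissipation S μ u x) S.cell := fun b hb hbδ =>
    (h.continuous_cutoff_mul_dissipation hδ hb hbδ).integrableOn_of_isBounded isBounded_cell
  have hle : ∫ y in S.cell, S.cutoff δ c y * dissipation S μ u y ≤ 0 := by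
    refine le_of_forall_pos_le_add fun ε hε => ?_
    -- The flux tolerance per object is `ε / (N + 1)`; the extra one covers `N = 0`.
    have hN : (0 : ℝ) < N + 1 := by positivity
    obtain ⟨b₀, hb₀, hb⟩ := hδ.exists_flux_le h.continuousOn_power h.power_add_shift h.flux_power
      (div_pos hε hN)
    have hbpos : 0 < min b₀ c := lt_min hb₀ hc
    obtain ⟨hbδ, hflux⟩ := hb (min b₀ c) hbpos (min_le_left _ _)
    -- The width `c` stays fixed, while a smaller width only enlarges the cutoff and makes the
    -- boundary flux small.
    calc ∫ y in S.cell, S.cutoff δ c y * dissipation S μ u y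
        ≤ ∫ y in S.cell, S.cutoff δ (min b₀ c) y * dissipation S μ u y :=
          setIntegral_mono (hint c hc hcδ) (hint _ hbpos hbδ) fun y =>
            mul_le_mul_of_nonneg_right (IsCollarWidth.cutoff_anti hbpos (min_le_right _ _) y)
              (dissipation_nonneg hμ y)
      _ ≤ N * (ε / (N + 1)) := by
          rw [h.integral_cutoff_mul_dissipation hδ hbpos hbδ]
          exact (neg_le_abs _).trans hflux
      _ ≤ 0 + ε := by
          rw [zero_add, ← mul_div_assoc, div_le_iff₀ hN]
          nlinarith
  have h0 := eq_zero_of_integral_cell_eq_zero (h.continuous_cutoff_mul_dissipation hδ hc hcδ)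
    (h.isPeriodic_cutoff_mul_dissipation hδ hc) (hnn c)
    (le_antisymm hle (setIntegral_nonneg measurableSet_cell fun y _ => hnn c y)) x
  simpa [hcx] using h0

end Energy

/-! ### From vanishing strain to constant velocity and pressure. -/

lemma partialWithin_antisymm (h : IsMobilitySolution S μ (fun _ => 0) u p v ω) (hμ : 0 < μ)
    {x : Plane} (hx : x ∈ S.fluid) (i j : Fin 2) :
    partialWithin S.closedFluid u x i j + partialWithin S.closedFluid u x j i = 0 := by
  have h0 := h.dissipation_eq_zero hμ hx
  rw [dissipation, mul_eq_zero_iff_left (by positivity)] at h0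
  have h1 := (Finset.sum_eq_zero_iff_of_nonneg fun i _ => Finset.sum_nonneg fun j _ =>
    sq_nonneg _).1 h0 i (Finset.mem_univ i)
  have h2 := (Finset.sum_eq_zero_iff_of_nonneg fun j _ => sq_nonneg _).1 h1 j (Finset.mem_univ j)
  exact pow_eq_zero_iff two_ne_zero |>.1 h2

lemma second_antisymm (h : IsMobilitySolution S μ (fun _ => 0) u p v ω) (hμ : 0 < μ)
    {x : Plane} (hx : x ∈ S.fluid) (i j k : Fin 2) :
    second u x i j k + second u x j i k = 0 := by
  obtain ⟨l, hl, hd⟩ := h.hasFDerivAt_partialWithin hx i j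
  obtain ⟨l', hl', hd'⟩ := h.hasFDerivAt_partialWithin hx j i
  have h2 : (fun y => partialWithin S.closedFluid u y i j + partialWithin S.closedFluid u y j i)
      =ᶠ[nhds x] fun _ => (0 : ℝ) := by
    filter_upwards [isOpen_fluid.mem_nhds hx] with y hy
    exact h.partialWithin_antisymm hμ hy i j
  have h3 := (hd.fun_add hd').unique ((hasFDerivAt_const (0 : ℝ) x).congr_of_eventuallyEq h2)
  have h4 := congrArg (fun l : Plane →L[ℝ] ℝ => l (coord k)) h3
  simpa [hl, hl'] using h4

/-- Antisymmetry in the first two indices and symmetry in the last two, used alternately three times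
each, return to the same entry with the opposite sign. -/
lemma second_eq_zero (h : IsMobilitySolution S μ (fun _ => 0) u p v ω) (hμ : 0 < μ)
    {x : Plane} (hx : x ∈ S.fluid) (i j k : Fin 2) : second u x i j k = 0 := by
  linarith [h.second_antisymm hμ hx i j k, h.second_symm hx j i k, h.second_antisymm hμ hx j k i,
    h.second_symm hx k j i, h.second_antisymm hμ hx k i j, h.second_symm hx i j k]

lemma fderiv_fderiv_eq_zero (h : IsMobilitySolution S μ (fun _ => 0) u p v ω) (hμ : 0 < μ)
    {x : Plane} (hx : x ∈ S.fluid) : fderiv ℝ (fderiv ℝ u) x = 0 := by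
  refine ContinuousLinearMap.ext fun a => ContinuousLinearMap.ext fun b => ?_
  rw [plane_eq_sum a, plane_eq_sum b]
  ext i
  have := h.second_eq_zero hμ hx i
  simp only [second] at this
  simp [this]

lemma fderiv_pressure_eq_zero (h : IsMobilitySolution S μ (fun _ => 0) u p v ω) (hμ : 0 < μ)
    {x : Plane} (hx : x ∈ S.fluid) : fderiv ℝ p x = 0 := by
  refine ContinuousLinearMap.ext fun a => ?_
  rw [plane_eq_sum a]
  simp only [map_add, map_smul, h.stokes_coord hx, h.second_eq_zero hμ hx]
  simp

/-- The velocity gradient is constant. -/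
lemma fderivWithin_eq (h : IsMobilitySolution S μ (fun _ => 0) u p v ω) (hμ : 0 < μ)
    {x y : Plane} (hx : x ∈ S.closedFluid) (hy : y ∈ S.closedFluid) :
    fderivWithin ℝ u S.closedFluid x = fderivWithin ℝ u S.closedFluid y := by
  refine eq_of_locally_constant_on_fluid (fun z hz => ?_) h.continuousOn_fderivWithin hx hy
  refine eventually_eq_of_fderiv_eq_zero (fun w hw => ?_) (fun w hw => ?_) hz
  · exact ((h.contDiffAt_fderivWithin hw).differentiableAt (by simp)).differentiableWithinAt
  · rw [(fderivWithin_eventuallyEq hw).fderiv_eq, h.fderiv_fderiv_eq_zero hμ hw]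

/-- The velocity is affine. -/
lemma velocity_eq_affine (h : IsMobilitySolution S μ (fun _ => 0) u p v ω) (hμ : 0 < μ)
    {x y : Plane} (hx : x ∈ S.closedFluid) (hy : y ∈ S.closedFluid) :
    u y = u x + fderivWithin ℝ u S.closedFluid x (y - x) := by
  set L := fderivWithin ℝ u S.closedFluid x with hL
  have hd : ∀ w ∈ S.fluid, HasFDerivAt (fun z => u z - L z) (0 : Plane →L[ℝ] Plane) w := by
    intro w hw
    have h1 : HasFDerivAt u L w := by
      rw [hL, h.fderivWithin_eq hμ hx (fluid_subset_closedFluid hw),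
        fderivWithin_of_mem_nhds (closedFluid_mem_nhds hw)]
      exact ((h.contDiffAt_velocity hw).differentiableAt (by simp)).hasFDerivAt
    simpa using h1.fun_sub L.hasFDerivAt
  have key : u y - L y = u x - L x :=
    eq_of_locally_constant_on_fluid (f := fun z => u z - L z)
      (fun z hz => eventually_eq_of_fderiv_eq_zero
        (fun w hw => (hd w hw).differentiableAt.differentiableWithinAt)
        (fun w hw => (hd w hw).fderiv) hz)
      (h.contDiffOn_velocity_closed.continuousOn.sub L.continuous.continuousOn) hy hx
  rw [map_sub]
  have h2 := sub_eq_iff_eq_add.1 key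
  rw [h2]
  abel

/-- An affine periodic map has a linear part that kills the lattice vectors, and these span the
plane. -/
theorem velocity_eq (h : IsMobilitySolution S μ (fun _ => 0) u p v ω) (hμ : 0 < μ)
    {x y : Plane} (hx : x ∈ S.closedFluid) (hy : y ∈ S.closedFluid) : u y = u x := by
  have hL : ∀ m₁ m₂, fderivWithin ℝ u S.closedFluid x (S.shift m₁ m₂) = 0 := fun m₁ m₂ => by
    have h1 := h.velocity_eq_affine hμ hx ((add_shift_mem_closedFluid m₁ m₂).2 hx)
    have h2 : u (x + S.shift m₁ m₂) = u x := h.periodic_velocity x hx m₁ m₂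
    rw [h2, add_sub_cancel_left] at h1
    simpa using h1.symm
  have hzero : fderivWithin ℝ u S.closedFluid x = 0 := by
    refine ContinuousLinearMap.coe_injective (S.basis.ext fun i => ?_)
    have h1 := hL 1 0
    have h2 := hL 0 1
    simp [shift, latticeVector] at h1 h2
    fin_cases i
    · simpa using h1
    · simpa using h2
  rw [h.velocity_eq_affine hμ hx hy, hzero]
  simp

theorem pressure_eq (h : IsMobilitySolution S μ (fun _ => 0) u p v ω) (hμ : 0 < μ)
    {x y : Plane} (hx : x ∈ S.closedFluid) (hy : y ∈ S.closedFluid) : p y = p x :=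
  eq_of_locally_constant_on_fluid
    (fun _ hz => eventually_eq_of_fderiv_eq_zero (h.contDiffOn_pressure.differentiableOn (by simp))
      (fun _ hw => h.fderiv_pressure_eq_zero hμ hw) hz)
    h.continuousOn_pressure_closed hy hx

end IsMobilitySolution
end PeriodicMobility
end

theorem lemmal {N : ℕ} (S : PeriodicMobility.Suspension N) (μ : ℝ) (hμ : 0 < μ)
    (u : PeriodicMobility.Plane → PeriodicMobility.Plane) (p : PeriodicMobility.Plane → ℝ)
    (v : Fin N → PeriodicMobility.Plane) (ω : Fin N → ℝ)
    (h : PeriodicMobility.IsMobilitySolution S μ (fun _ => 0) u p v ω) :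
    (∃ c : PeriodicMobility.Plane, ∀ x ∈ S.closedFluid, u x = c) ∧
      ∃ q : ℝ, ∀ x ∈ S.closedFluid, p x = q := by
  -- The empty case never occurs, as boundary curves lie in the closed fluid, but it is trivial to
  -- dispose of.
  rcases S.closedFluid.eq_empty_or_nonempty with h0 | ⟨x₀, hx₀⟩
  · exact ⟨⟨0, by simp [h0]⟩, 0, by simp [h0]⟩
  · exact ⟨⟨u x₀, fun x hx => h.velocity_eq hμ hx₀ hx⟩,
      p x₀, fun x hx => h.pressure_eq hμ hx₀ hx⟩
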